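/- **Setting.** Let $X$ be a set of $n$ elements; element $e$ is active independently with probability $p_e\in[0,1]$. Let $\mathcal F$ be a non-empty family of sequences of distinct elements of $X$ that is closed under taking prefixes. Let $f(S)=\max_{1\le i\le W}\sum_{e\in S}a_i(e)$, with $a_i(e)\ge 0$, be a monotone XOS function on the subsets of $X$, given by a max-of-sums representation of width $W\ge 1$. A *non-adaptive strategy* is a sequence $\sigma\in\mathcal F$; its value is $\mathbb E_R[f(R\cap\sigma)]$, where $R$ is the random set of active elements. An *adaptive strategy* is a binary tree in which every internal node probes an element and branches on whether that element is active, and in which the probed sequence along every root-leaf path belongs to $\mathcal F$; its value is $\mathbb E_\ell[f(A_\ell)]$, where $\ell$ is the random leaf that is reached and $A_\ell$ is the set of active elements found on the way to $\ell$. A *linear oracle* for $\mathcal F$ returns, for any given weights $c:X\to\mathbb R_{\ge 0}$, a sequence $\sigma\in\mathcal F$ that maximizes $\sum_{e\in\sigma}c(e)$. **Theorem.** There is an algorithm (a single program for a real random access machine with unit-cost arithmetic, independent of $n$, $W$ and of the instance) that, given $n$, $W$, the probabilities $p_e$, the coefficients $a_i(e)$, and access to a linear oracle for $\mathcal F$,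 outputs a sequence $\sigma\in\mathcal F$ such that $$\text{value of every adaptive strategy}\ \le\ C\,(1+\log W)\cdot \mathbb E_R[f(R\cap\sigma)].$$ It runs in time $\mathrm{poly}(n,W)$ and makes at most $D\,(W+\log n)$ oracle calls (reading $\log 0$ as $0$), and its output $\sigma$ is one of the sequences returned by these calls. The constants $C$, $D$ and the polynomial are absolute. -/

import Mathlib

namespace StochasticProbing

/-! ### The stochastic probing problem -/

/-- A family of feasible probing sequences (no element is probed twice) that is non-empty and closed
under taking prefixes. -/
structure IsPrefixClosed {n : ℕ} (F : Set (List (Fin n))) : Prop where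
  nonempty : F.Nonempty
  nodup : ∀ σ ∈ F, σ.Nodup
  prefix_mem : ∀ σ ∈ F, ∀ τ : List (Fin n), τ <+: σ → τ ∈ F

/-- `f` is the monotone XOS function given by the max-of-sums representation `a`:
the coefficients are non-negative and `f S = max_i ∑_{e ∈ S} a_i(e)`. -/
structure IsMaxOfSums {n W : ℕ} (a : Fin W → Fin n → ℝ) (f : Finset (Fin n) → ℝ) : Prop where
  coeff_nonneg : ∀ i e, 0 ≤ a i e
  isGreatest : ∀ S, IsGreatest (Set.range fun i => ∑ e ∈ S, a i e) (f S)

/-- `f^max S` is the largest value of a subset of `S`. -/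
noncomputable def fmax {n : ℕ} (f : Finset (Fin n) → ℝ) (S : Finset (Fin n)) : ℝ :=
  S.powerset.sup' ⟨∅, Finset.empty_mem_powerset S⟩ f

/-- Adaptive strategy trees: an internal node probes `e` and continues with the first subtree if `e`
is inactive and with the second subtree if `e` is active. -/
inductive StrategyTree (n : ℕ) : Type
  | leaf : StrategyTree n
  | node (e : Fin n) (no yes : StrategyTree n) : StrategyTree n

/-- Every root-leaf path of the tree, prolonging the already probed sequence `pre`, is feasible. -/
def StrategyTree.FeasibleFrom {n : ℕ} (F : Set (List (Fin n))) :
    List (Fin n) → StrategyTree n → Prop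
  | pre, .leaf => pre ∈ F
  | pre, .node e no yes => no.FeasibleFrom F (pre ++ [e]) ∧ yes.FeasibleFrom F (pre ++ [e])

def StrategyTree.Feasible {n : ℕ} (F : Set (List (Fin n))) (T : StrategyTree n) : Prop :=
  T.FeasibleFrom F []

/-- Expected value of `f^max` at the random leaf of the tree, `A` being the set of elements that were
already found active. -/
noncomputable def StrategyTree.valueFrom {n : ℕ} (p : Fin n → ℝ) (f : Finset (Fin n) → ℝ) :
    Finset (Fin n) → StrategyTree n → ℝ
  | A, .leaf => fmax f A
  | A, .node e no yes => (1 - p e) * no.valueFrom p f A + p e * yes.valueFrom p f (insert e A)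

/-- `adap(T, f)`, the expected value of the adaptive strategy `T`. -/
noncomputable def adap {n : ℕ} (p : Fin n → ℝ) (f : Finset (Fin n) → ℝ) (T : StrategyTree n) : ℝ :=
  T.valueFrom p f ∅

/-- The expected value `𝔼_{R ∼ X(p)} [f^max (R ∩ σ)]` of the non-adaptive strategy that probes the
sequence `σ`; the set `R` contains each element `e` independently with probability `p e`. -/
noncomputable def nonadap {n : ℕ} (p : Fin n → ℝ) (f : Finset (Fin n) → ℝ) (σ : List (Fin n)) : ℝ :=
  ∑ R : Finset (Fin n), (∏ e ∈ R, p e) * (∏ e ∈ Rᶜ, (1 - p e)) * fmax f (R ∩ σ.toFinset)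

/-- `O` answers every non-negative linear function with a feasible sequence that maximizes it.
Nothing is required on weights of which one is negative. -/
def IsLinearOracle {n : ℕ} (F : Set (List (Fin n))) (O : (Fin n → ℝ) → List (Fin n)) : Prop :=
  ∀ c : Fin n → ℝ, (∀ e, 0 ≤ c e) →
    O c ∈ F ∧ ∀ τ ∈ F, ∑ e ∈ τ.toFinset, c e ≤ ∑ e ∈ (O c).toFinset, c e

/-! ### Real random access machines with an oracle

The machine has an index memory of natural numbers and a real memory, both organised in rows and
columns. Row and column of a cell may be computed. Real arithmetic has unit cost; indices can only
be added and (truncatedly) subtracted. Programs are uniform: they do not depend on the input size,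
and contain bounded loops as the only form of iteration, so that they always terminate. -/

structure State (n : ℕ) where
  /-- index memory -/
  I : ℕ → ℕ → ℕ
  /-- real memory -/
  R : ℕ → ℕ → ℝ
  /-- number of steps made so far -/
  time : ℕ
  /-- the oracle queries made so far -/
  queries : List (Fin n → ℝ)

/-- Index expressions. -/
inductive IExp : Type
  | const (k : ℕ) : IExp
  | cell (r c : IExp) : IExp
  | add (x y : IExp) : IExp
  | sub (x y : IExp) : IExp

def IExp.eval {n : ℕ} (s : State n) : IExp → ℕ
  | .const k => k
  | .cell r c => s.I (r.eval s) (c.eval s)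
  | .add x y => x.eval s + y.eval s
  | .sub x y => x.eval s - y.eval s

/-- Number of steps needed to evaluate an index expression. -/
def IExp.cost : IExp → ℕ
  | .const _ => 1
  | .cell r c => r.cost + c.cost + 1
  | .add x y => x.cost + y.cost + 1
  | .sub x y => x.cost + y.cost + 1

/-- Real expressions. Division by zero returns zero. -/
inductive RExp : Type
  | const (q : ℚ) : RExp
  | cell (r c : IExp) : RExp
  | add (x y : RExp) : RExp
  | sub (x y : RExp) : RExp
  | mul (x y : RExp) : RExp
  | div (x y : RExp) : RExp

noncomputable def RExp.eval {n : ℕ} (s : State n) : RExp → ℝ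
  | .const q => (q : ℝ)
  | .cell r c => s.R (r.eval s) (c.eval s)
  | .add x y => x.eval s + y.eval s
  | .sub x y => x.eval s - y.eval s
  | .mul x y => x.eval s * y.eval s
  | .div x y => x.eval s / y.eval s

/-- Number of steps needed to evaluate a real expression. -/
def RExp.cost : RExp → ℕ
  | .const _ => 1
  | .cell r c => r.cost + c.cost + 1
  | .add x y => x.cost + y.cost + 1
  | .sub x y => x.cost + y.cost + 1
  | .mul x y => x.cost + y.cost + 1
  | .div x y => x.cost + y.cost + 1

/-- Tests `x ≤ y` between two indices or between two real numbers. -/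
inductive Test : Type
  | ile (x y : IExp) : Test
  | rle (x y : RExp) : Test

def Test.Holds {n : ℕ} (s : State n) : Test → Prop
  | .ile x y => x.eval s ≤ y.eval s
  | .rle x y => x.eval s ≤ y.eval s

def Test.cost : Test → ℕ
  | .ile x y => x.cost + y.cost + 1
  | .rle x y => x.cost + y.cost + 1

/-- Programs. -/
inductive Program : Type
  /-- do nothing -/
  | skip : Program
  /-- index assignment `I[r, c] := x` -/
  | setI (r c x : IExp) : Program
  /-- real assignment `R[r, c] := x` -/
  | setR (r c : IExp) (x : RExp) : Program
  /-- first `P`, then `Q` -/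
  | seq (P Q : Program) : Program
  /-- if `t` then `P` else `Q` -/
  | ite (t : Test) (P Q : Program) : Program
  /-- run `P` as often as the value of `k` on entry says -/
  | loop (k : IExp) (P : Program) : Program
  /-- query the oracle with the weights `e ↦ R[r, e]`; the answer `[e₁, …, eₗ]` is stored by
  `I[d, 0] := l` and `I[d, j] := eⱼ` for `1 ≤ j ≤ l` -/
  | query (r d : IExp) : Program

def State.tick {n : ℕ} (s : State n) (k : ℕ) : State n := { s with time := s.time + k }

def State.writeI {n : ℕ} (s : State n) (r c x : ℕ) : State n :=
  { s with I := Function.update s.I r (Function.update (s.I r) c x) }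

noncomputable def State.writeR {n : ℕ} (s : State n) (r c : ℕ) (x : ℝ) : State n :=
  { s with R := Function.update s.R r (Function.update (s.R r) c x) }

/-- Store the list `σ` in row `d` of the index memory, its length in column `0`. -/
def State.writeList {n : ℕ} (s : State n) (d : ℕ) (σ : List (Fin n)) : State n :=
  { s with I := Function.update s.I d fun c =>
      match c with
      | 0 => σ.length
      | j + 1 => (σ.map Fin.val).getD j (s.I d (j + 1)) }

/-- The oracle query with the weights in row `r`, the answer being stored in row `d`. -/
def State.ask {n : ℕ} (O : (Fin n → ℝ) → List (Fin n)) (s : State n) (r d : ℕ) : State n :=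
  let c : Fin n → ℝ := fun e => s.R r e
  { s.writeList d (O c) with queries := s.queries ++ [c] }

open Classical in
/-- The state after running a program with oracle `O`. Every operation, assignment, test and loop
iteration costs one step; an oracle query costs `n + 1` steps. -/
noncomputable def Program.exec {n : ℕ} (O : (Fin n → ℝ) → List (Fin n)) :
    Program → State n → State n
  | .skip, s => s.tick 1
  | .setI r c x, s =>
      (s.writeI (r.eval s) (c.eval s) (x.eval s)).tick (r.cost + c.cost + x.cost + 1)
  | .setR r c x, s =>
      (s.writeR (r.eval s) (c.eval s) (x.eval s)).tick (r.cost + c.cost + x.cost + 1)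
  | .seq P Q, s => Q.exec O (P.exec O s)
  | .ite t P Q, s =>
      if t.Holds s then P.exec O (s.tick (t.cost + 1)) else Q.exec O (s.tick (t.cost + 1))
  | .loop k P, s => (fun u => (P.exec O u).tick 1)^[k.eval s] (s.tick (k.cost + 1))
  | .query r d, s => (s.ask O (r.eval s) (d.eval s)).tick (r.cost + d.cost + n + 1)

/-- The initial state on input `(p, a)`: `I[0, 0] = n`, `I[0, 1] = W`, `R[0, e] = p e` and
`R[i + 1, e] = a i e`; all other cells are zero. -/
noncomputable def State.init {n W : ℕ} (p : Fin n → ℝ) (a : Fin W → Fin n → ℝ) : State n where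
  I := fun r c => if r = 0 ∧ c = 0 then n else if r = 0 ∧ c = 1 then W else 0
  R := fun r c =>
    if hc : c < n then
      match r with
      | 0 => p ⟨c, hc⟩
      | i + 1 => if hi : i < W then a ⟨i, hi⟩ ⟨c, hc⟩ else 0
    else 0
  time := 0
  queries := []

/-- The output is the list stored in row `1` of the index memory, its length in column `0`. -/
def State.output {n : ℕ} (s : State n) : List ℕ :=
  (List.range (s.I 1 0)).map fun j => s.I 1 (j + 1)

/-- The final state of the program with oracle `O` on input `(p, a)`. -/
noncomputable def Program.run {n W : ℕ} (P : Program) (O : (Fin n → ℝ) → List (Fin n))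
    (p : Fin n → ℝ) (a : Fin W → Fin n → ℝ) : State n :=
  P.exec O (State.init p a)

end StochasticProbing

open StochasticProbing

/-! Let `m` be the value of an adaptive strategy and `M` the largest expectation `∑ p e * a i e` of
a single summand on a feasible sequence. For a threshold `t`, let `L` be the largest total of `p e *
f {e}` over the large elements (`t ≤ f {e}`) of a feasible sequence.

Upper bounds on `m` come from functions of the history whose expectation cannot increase
(`IsExcessive`) and which dominate `f` at every leaf (`StrategyTree.valueFrom_le`). Replacing the
maximum by a sum gives `m ≤ W M` (`adap_le_width_mul`). Charging large elements separately and
controlling the maximum over the small coefficients by exponential moments gives `m ≤ L + t log W +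
2 M` (`adap_le_of_threshold`).

A fixed sequence earns at least the expectation of each summand (`sum_le_nonadap`) and at least `L'
/ (1 + P')`, where `L'` and `P'` are the total contribution and probability of its large elements
(`sum_div_le_nonadap`). For the sequence attaining `L` the latter is at least `min L t / 2`. These
certificates are computable without averaging over the exponentially many active sets, so the
machine compares answers by them.

If `m` is at most `8 (1 + log W) M`, the best summand suffices. Otherwise a threshold near `m / (4
(1 + log W))` forces `L ≥ m / 2`, so its certificate is of order `m / (1 + log W)`. Although `m` is
unknown, `m ≤ W M` shows that one of `M, 2M, …, WM` is such a threshold (`adap_le_of_scores`). This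
takes `W` queries for summands, `W` for thresholds, and one to repeat the best.

The rest verifies a program doing this. Its central invariant is that the best score never exceeds
the value of the oracle's answer to the remembered query. -/

namespace StochasticProbing

variable {n W : ℕ}

/-! ### Max-of-sums functions -/

namespace IsMaxOfSums

variable {a : Fin W → Fin n → ℝ} {f : Finset (Fin n) → ℝ}

theorem sum_le (h : IsMaxOfSums a f) (S : Finset (Fin n)) (i : Fin W) : ∑ e ∈ S, a i e ≤ f S :=
  (h.isGreatest S).2 ⟨i, rfl⟩

theorem exists_eq (h : IsMaxOfSums a f) (S : Finset (Fin n)) : ∃ i, f S = ∑ e ∈ S, a i e := by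
  obtain ⟨i, hi⟩ := (h.isGreatest S).1
  exact ⟨i, hi.symm⟩

theorem width_pos (h : IsMaxOfSums a f) : 0 < W := by
  obtain ⟨i, -⟩ := h.exists_eq ∅
  exact i.pos

theorem nonneg (h : IsMaxOfSums a f) (S : Finset (Fin n)) : 0 ≤ f S := by
  obtain ⟨i, hi⟩ := h.exists_eq S
  exact hi ▸ Finset.sum_nonneg fun e _ => h.coeff_nonneg i e

theorem mono (h : IsMaxOfSums a f) : Monotone f := by
  intro S T hST
  obtain ⟨i, hi⟩ := h.exists_eq S
  rw [hi]
  exact (Finset.sum_le_sum_of_subset_of_nonneg hST fun e _ _ => h.coeff_nonneg i e).trans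
    (h.sum_le T i)

theorem coeff_le_singleton (h : IsMaxOfSums a f) (i : Fin W) (e : Fin n) : a i e ≤ f {e} := by
  simpa using h.sum_le {e} i

theorem fmax_eq (h : IsMaxOfSums a f) (S : Finset (Fin n)) : fmax f S = f S :=
  le_antisymm (Finset.sup'_le _ _ fun _ hT => h.mono (Finset.mem_powerset.1 hT))
    (Finset.le_sup' f (Finset.mem_powerset_self S))

end IsMaxOfSums

/-! ### Potential functions on strategy trees -/

/-- A function of the probed sequence and the set of active elements found so far whose expected
value does not increase when one more element is probed. -/
def IsExcessive (p : Fin n → ℝ) (Ψ : List (Fin n) → Finset (Fin n) → ℝ) : Prop :=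
  ∀ pre e A, e ∉ pre → e ∉ A →
    (1 - p e) * Ψ (pre ++ [e]) A + p e * Ψ (pre ++ [e]) (insert e A) ≤ Ψ pre A

theorem StrategyTree.FeasibleFrom.prefix_mem {F : Set (List (Fin n))} (hF : IsPrefixClosed F) :
    ∀ {T : StrategyTree n} {pre : List (Fin n)}, T.FeasibleFrom F pre → pre ∈ F
  | .leaf, _, h => h
  | .node e _ _, pre, h => hF.prefix_mem _ (h.1.prefix_mem hF) pre (List.prefix_append pre [e])

/-- Optional stopping, by induction on the tree. Feasible sequences have no repetitions, so each
probed element is new, as `IsExcessive` demands. -/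
theorem StrategyTree.valueFrom_le {p : Fin n → ℝ} (hp : ∀ e, p e ∈ Set.Icc (0 : ℝ) 1)
    {f : Finset (Fin n) → ℝ} {F : Set (List (Fin n))} (hF : IsPrefixClosed F)
    {Ψ : List (Fin n) → Finset (Fin n) → ℝ} (hΨ : IsExcessive p Ψ)
    (hleaf : ∀ pre ∈ F, ∀ A, fmax f A ≤ Ψ pre A) :
    ∀ (T : StrategyTree n) (pre : List (Fin n)) (A : Finset (Fin n)),
      T.FeasibleFrom F pre → A ⊆ pre.toFinset → T.valueFrom p f A ≤ Ψ pre A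
  | .leaf, pre, A, h, _ => hleaf pre h A
  | .node e no yes, pre, A, h, hA => by
    have hnd := hF.nodup _ (h.1.prefix_mem hF)
    have he : e ∉ pre := by
      rw [List.nodup_append] at hnd
      exact fun hmem => hnd.2.2 e hmem e (by simp) rfl
    have heA : e ∉ A := fun hmem => he (by simpa using hA hmem)
    have h1 := no.valueFrom_le hp hF hΨ hleaf (pre ++ [e]) A h.1
      (hA.trans (by intro x hx; simp_all))
    have h2 := yes.valueFrom_le hp hF hΨ hleaf (pre ++ [e]) (insert e A) h.2
      (by intro x hx
          rcases Finset.mem_insert.1 hx with rfl | hx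
          · simp
          · have := hA hx; simp_all)
    refine le_trans ?_ (hΨ pre e A he heA)
    exact add_le_add (mul_le_mul_of_nonneg_left h1 (by linarith [(hp e).2]))
      (mul_le_mul_of_nonneg_left h2 (hp e).1)

namespace IsExcessive

variable {p : Fin n → ℝ}

theorem const (x : ℝ) : IsExcessive p fun _ _ => x := by
  intro pre e A _ _
  exact le_of_eq (by ring)

theorem add {Ψ Ψ' : List (Fin n) → Finset (Fin n) → ℝ} (h : IsExcessive p Ψ)
    (h' : IsExcessive p Ψ') : IsExcessive p fun pre A => Ψ pre A + Ψ' pre A := by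
  intro pre e A he heA
  have := h pre e A he heA
  have := h' pre e A he heA
  dsimp only
  linarith

theorem const_mul {Ψ : List (Fin n) → Finset (Fin n) → ℝ} (h : IsExcessive p Ψ) {x : ℝ}
    (hx : 0 ≤ x) : IsExcessive p fun pre A => x * Ψ pre A := by
  intro pre e A he heA
  have := mul_le_mul_of_nonneg_left (h pre e A he heA) hx
  dsimp only
  linarith

theorem sum {ι : Type*} (s : Finset ι) {Ψ : ι → List (Fin n) → Finset (Fin n) → ℝ}
    (h : ∀ i, IsExcessive p (Ψ i)) : IsExcessive p fun pre A => ∑ i ∈ s, Ψ i pre A := by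
  intro pre e A he heA
  simp only [Finset.mul_sum, ← Finset.sum_add_distrib]
  exact Finset.sum_le_sum fun i _ => h i pre e A he heA

theorem _root_.List.sum_toFinset_append_singleton {α : Type*} [DecidableEq α] {l : List α} {x : α}
    (hx : x ∉ l) (g : α → ℝ) :
    ∑ y ∈ (l ++ [x]).toFinset, g y = ∑ y ∈ l.toFinset, g y + g x := by
  have : (l ++ [x]).toFinset = insert x l.toFinset := by ext; simp
  rw [this, Finset.sum_insert (by simpa using hx), add_comm]

theorem linear (w : Fin n → ℝ) :
    IsExcessive p fun pre A => ∑ e ∈ A, w e - ∑ e ∈ pre.toFinset, p e * w e := by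
  intro pre e A he heA
  simp only [Finset.sum_insert heA, List.sum_toFinset_append_singleton he]
  exact le_of_eq (by ring)

/-- One probe multiplies the exponential moment by `1 - p + p e^u ≤ 1 + 2pu ≤ e^(2pu)`, which the
doubled compensator cancels. -/
theorem exp (hp : ∀ e, p e ∈ Set.Icc (0 : ℝ) 1) {u : Fin n → ℝ}
    (hu : ∀ e, u e ∈ Set.Icc (0 : ℝ) 1) :
    IsExcessive p fun pre A =>
      Real.exp (∑ e ∈ A, u e - 2 * ∑ e ∈ pre.toFinset, p e * u e) := by
  intro pre e A he heA
  simp only [Finset.sum_insert heA, List.sum_toFinset_append_singleton he]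
  set X := ∑ e ∈ A, u e
  set Y := ∑ e ∈ pre.toFinset, p e * u e
  have h1 : Real.exp (X - 2 * (Y + p e * u e))
      = Real.exp (X - 2 * Y) * Real.exp (-(2 * (p e * u e))) := by
    rw [← Real.exp_add]; ring_nf
  have h2 : Real.exp (u e + X - 2 * (Y + p e * u e))
      = Real.exp (X - 2 * Y) * Real.exp (-(2 * (p e * u e))) * Real.exp (u e) := by
    rw [← Real.exp_add, ← Real.exp_add]; ring_nf
  rw [h1, h2]
  obtain ⟨hp0, hp1⟩ := hp e
  obtain ⟨hu0, hu1⟩ := hu e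
  -- On the unit interval `e^u - 1 - u ≤ u² ≤ u`; this is where the factor 2 arises.
  have h3 : Real.exp (u e) ≤ 1 + 2 * u e := by
    have := (abs_le.1 (Real.abs_exp_sub_one_sub_id_le (x := u e) (by rwa [abs_of_nonneg hu0]))).2
    nlinarith
  have h4 : 1 - p e + p e * Real.exp (u e) ≤ Real.exp (2 * (p e * u e)) := by
    have := Real.add_one_le_exp (2 * (p e * u e))
    nlinarith
  calc _ = Real.exp (X - 2 * Y) * (Real.exp (-(2 * (p e * u e)))
        * (1 - p e + p e * Real.exp (u e))) := by ring
    _ ≤ Real.exp (X - 2 * Y) * (Real.exp (-(2 * (p e * u e))) * Real.exp (2 * (p e * u e))) := by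
        gcongr
    _ = Real.exp (X - 2 * Y) := by rw [← Real.exp_add]; simp

end IsExcessive

/-! ### Upper bounds for adaptive strategies -/

section Adaptive

variable {p : Fin n → ℝ} {a : Fin W → Fin n → ℝ} {f : Finset (Fin n) → ℝ}
  {F : Set (List (Fin n))}

/-- Each centred summand is a martingale; shifted by `M` it is non-negative at leaves, so the sum
over `i` dominates the maximum there. -/
theorem adap_le_width_mul (hp : ∀ e, p e ∈ Set.Icc (0 : ℝ) 1) (hf : IsMaxOfSums a f)
    (hF : IsPrefixClosed F) {M : ℝ}
    (hM : ∀ i, ∀ τ ∈ F, ∑ e ∈ τ.toFinset, p e * a i e ≤ M)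
    {T : StrategyTree n} (hT : T.Feasible F) : adap p f T ≤ W * M := by
  have hΨ : IsExcessive p fun pre A => ∑ i : Fin W,
      ((∑ e ∈ A, a i e - ∑ e ∈ pre.toFinset, p e * a i e) + M) :=
    IsExcessive.sum _ fun i => (IsExcessive.linear (a i)).add (IsExcessive.const M)
  have := T.valueFrom_le hp hF (f := f) hΨ (fun pre hpre A => ?_) [] ∅ hT (by simp)
  · simpa [adap] using this
  · rw [hf.fmax_eq]
    obtain ⟨i, hi⟩ := hf.exists_eq A
    rw [hi]
    refine le_trans ?_ (Finset.single_le_sum (fun j _ => ?_) (Finset.mem_univ i))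
    · linarith [hM i pre hpre]
    · have := Finset.sum_nonneg fun e (_ : e ∈ A) => hf.coeff_nonneg j e
      linarith [hM j pre hpre]

/-- The potential adds a centred sum for the large elements, the average over `i` of the exponential
moments of the small coefficients, and a constant. -/
theorem adap_le_of_threshold (hp : ∀ e, p e ∈ Set.Icc (0 : ℝ) 1) (hf : IsMaxOfSums a f)
    (hF : IsPrefixClosed F) {M L t : ℝ} (ht : 0 < t)
    (hM : ∀ i, ∀ τ ∈ F, ∑ e ∈ τ.toFinset, p e * a i e ≤ M)
    (hL : ∀ τ ∈ F, ∑ e ∈ τ.toFinset, (if t ≤ f {e} then p e * f {e} else 0) ≤ L)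
    {T : StrategyTree n} (hT : T.Feasible F) : adap p f T ≤ L + t * Real.log W + 2 * M := by
  have hW : (0 : ℝ) < W := by exact_mod_cast hf.width_pos
  -- Large elements are charged in full to `w`. The other coefficients are below `t`, so after
  -- scaling they satisfy the hypothesis of `IsExcessive.exp`.
  let w : Fin n → ℝ := fun e => if t ≤ f {e} then f {e} else 0
  let u : Fin W → Fin n → ℝ := fun i e => if t ≤ f {e} then 0 else a i e / t
  have hu : ∀ i e, u i e ∈ Set.Icc (0 : ℝ) 1 := by
    intro i e
    simp only [u]
    split_ifs with h
    · simp
    · exact ⟨div_nonneg (hf.coeff_nonneg i e) ht.le,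
        (div_le_one ht).2 ((hf.coeff_le_singleton i e).trans (not_le.1 h).le)⟩
  have hpu : ∀ i, ∀ τ ∈ F, ∑ e ∈ τ.toFinset, p e * u i e ≤ M / t := by
    intro i τ hτ
    rw [le_div_iff₀ ht, Finset.sum_mul]
    refine (Finset.sum_le_sum fun e _ => ?_).trans (hM i τ hτ)
    simp only [u]
    split_ifs
    · simpa using mul_nonneg (hp e).1 (hf.coeff_nonneg i e)
    · exact le_of_eq (by field_simp)
  have hpw : ∀ τ ∈ F, ∑ e ∈ τ.toFinset, p e * w e ≤ L := by
    intro τ hτ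
    simpa [w] using hL τ hτ
  have hΨ : IsExcessive p fun pre A =>
      ((∑ e ∈ A, w e - ∑ e ∈ pre.toFinset, p e * w e) + (L + t * (Real.log W + 2 * (M / t) - 1)))
      + t / W * ∑ i : Fin W, Real.exp (∑ e ∈ A, u i e - 2 * ∑ e ∈ pre.toFinset, p e * u i e) :=
    ((IsExcessive.linear w).add (IsExcessive.const _)).add
      ((IsExcessive.sum _ fun i => IsExcessive.exp hp (hu i)).const_mul (by positivity))
  have := T.valueFrom_le hp hF (f := f) hΨ (fun pre hpre A => ?_) [] ∅ hT (by simp)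
  · refine this.trans (le_of_eq ?_)
    simp only [Finset.sum_empty, List.toFinset_nil, sub_zero, mul_zero, Real.exp_zero,
      Finset.sum_const, Finset.card_univ, Fintype.card_fin, nsmul_eq_mul, mul_one, zero_add]
    field_simp
    ring
  · rw [hf.fmax_eq]
    obtain ⟨i, hi⟩ := hf.exists_eq A
    set X := ∑ e ∈ A, u i e
    have h1 : f A ≤ ∑ e ∈ A, w e + t * X := by
      rw [hi, Finset.mul_sum, ← Finset.sum_add_distrib]
      refine Finset.sum_le_sum fun e _ => ?_
      simp only [w, u]
      split_ifs
      · simpa using hf.coeff_le_singleton i e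
      · exact le_of_eq (by field_simp; ring)
    have h2 : X ≤ Real.log W + 2 * (M / t) - 1
        + Real.exp (X - 2 * (M / t)) / W := by
      -- A tangent bound replaces the logarithm of an exponential moment by something linear in that
      -- moment. The resulting `-1` cancels at the root, where the `W` exponentials average to 1.
      have := Real.add_one_le_exp (X - 2 * (M / t) - Real.log W)
      rw [Real.exp_sub _ (Real.log W), Real.exp_log hW] at this
      linarith
    have h3 : Real.exp (X - 2 * (M / t))
        ≤ ∑ i : Fin W, Real.exp (∑ e ∈ A, u i e - 2 * ∑ e ∈ pre.toFinset, p e * u i e) := by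
      refine le_trans (Real.exp_le_exp.2 ?_) (Finset.single_le_sum
        (f := fun i => Real.exp (∑ e ∈ A, u i e - 2 * ∑ e ∈ pre.toFinset, p e * u i e))
        (fun j _ => (Real.exp_pos _).le) (Finset.mem_univ i))
      linarith [hpu i pre hpre]
    have h4 := hpw pre hpre
    calc f A ≤ ∑ e ∈ A, w e + t * X := h1
      _ ≤ ∑ e ∈ A, w e + t * (Real.log W + 2 * (M / t) - 1
          + (∑ i : Fin W, Real.exp (∑ e ∈ A, u i e - 2 * ∑ e ∈ pre.toFinset, p e * u i e)) / W) := by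
          gcongr
          refine h2.trans ?_
          gcongr
      _ ≤ _ := by
          have : t * ((∑ i : Fin W,
              Real.exp (∑ e ∈ A, u i e - 2 * ∑ e ∈ pre.toFinset, p e * u i e)) / W)
              = t / W * ∑ i : Fin W,
              Real.exp (∑ e ∈ A, u i e - 2 * ∑ e ∈ pre.toFinset, p e * u i e) := by ring
          rw [mul_add t (Real.log W + 2 * (M / t) - 1), this]
          linarith

end Adaptive

/-! ### Lower bounds for non-adaptive strategies -/

/-- The probability that `R` is the set of active elements. -/
noncomputable def activeProb (p : Fin n → ℝ) (R : Finset (Fin n)) : ℝ :=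
  (∏ e ∈ R, p e) * ∏ e ∈ Rᶜ, (1 - p e)

theorem activeProb_nonneg {p : Fin n → ℝ} (hp : ∀ e, p e ∈ Set.Icc (0 : ℝ) 1)
    (R : Finset (Fin n)) : 0 ≤ activeProb p R :=
  mul_nonneg (Finset.prod_nonneg fun e _ => (hp e).1)
    (Finset.prod_nonneg fun e _ => by linarith [(hp e).2])

theorem sum_activeProb_superset (p : Fin n → ℝ) (S : Finset (Fin n)) :
    ∑ R, (if S ⊆ R then activeProb p R else 0) = ∏ e ∈ S, p e := by
  -- Setting the inactive factor to zero on `S` removes exactly the sets not containing `S` from the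
  -- expanded product.
  have h := Finset.prod_add p (fun e => if e ∈ S then 0 else 1 - p e) Finset.univ
  have h1 : ∏ e, (p e + if e ∈ S then 0 else 1 - p e) = ∏ e ∈ S, p e := by
    rw [← Finset.prod_subset (Finset.subset_univ S) (f := fun e => p e + if e ∈ S then 0 else 1 - p e)
      (fun e _ he => by simp [he])]
    exact Finset.prod_congr rfl fun e he => by simp [he]
  rw [← h1, h, Finset.powerset_univ]
  refine Finset.sum_congr rfl fun R _ => ?_
  rw [← Finset.compl_eq_univ_sdiff]
  split_ifs with hS
  · rw [activeProb]
    congr 1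
    refine Finset.prod_congr rfl fun e he => ?_
    rw [if_neg fun h => (Finset.mem_compl.1 he) (hS h)]
  · obtain ⟨e, heS, heR⟩ := Finset.not_subset.1 hS
    rw [Finset.prod_eq_zero (Finset.mem_compl.2 heR) (by simp [heS]), mul_zero]

theorem sum_activeProb_mem (p : Fin n → ℝ) (e : Fin n) :
    ∑ R : Finset (Fin n), activeProb p R * (if e ∈ R then 1 else 0) = p e := by
  rw [← Finset.prod_singleton p e, ← sum_activeProb_superset]
  simp

/-- The product over the set `{e, e'}` also covers `e = e'`, where it is `p e` and not its square.
-/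
theorem sum_activeProb_pair_mem (p : Fin n → ℝ) (e e' : Fin n) :
    ∑ R : Finset (Fin n), activeProb p R * ((if e ∈ R then 1 else 0) * if e' ∈ R then 1 else 0)
      = ∏ x ∈ {e, e'}, p x := by
  rw [← sum_activeProb_superset]
  refine Finset.sum_congr rfl fun R _ => ?_
  simp only [Finset.insert_subset_iff, Finset.singleton_subset_iff]
  by_cases h : e ∈ R <;> by_cases h' : e' ∈ R <;> simp [h, h']

section NonAdaptive

variable {p : Fin n → ℝ} {a : Fin W → Fin n → ℝ} {f : Finset (Fin n) → ℝ}

theorem nonadap_eq (hf : IsMaxOfSums a f) (σ : List (Fin n)) :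
    nonadap p f σ = ∑ R, activeProb p R * f (R ∩ σ.toFinset) := by
  simp only [nonadap, activeProb, hf.fmax_eq]

theorem nonadap_nonneg (hp : ∀ e, p e ∈ Set.Icc (0 : ℝ) 1) (hf : IsMaxOfSums a f)
    (σ : List (Fin n)) : 0 ≤ nonadap p f σ := by
  rw [nonadap_eq hf]
  exact Finset.sum_nonneg fun R _ => mul_nonneg (activeProb_nonneg hp R) (hf.nonneg _)

theorem sum_le_nonadap (hp : ∀ e, p e ∈ Set.Icc (0 : ℝ) 1) (hf : IsMaxOfSums a f)
    (σ : List (Fin n)) (i : Fin W) :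
    ∑ e ∈ σ.toFinset, p e * a i e ≤ nonadap p f σ := by
  rw [nonadap_eq hf]
  calc ∑ e ∈ σ.toFinset, p e * a i e
      = ∑ e ∈ σ.toFinset, ∑ R : Finset (Fin n),
          activeProb p R * (if e ∈ R then 1 else 0) * a i e := by
        simp only [← Finset.sum_mul, sum_activeProb_mem]
    _ = ∑ R, activeProb p R * ∑ e ∈ R ∩ σ.toFinset, a i e := by
        rw [Finset.sum_comm]
        refine Finset.sum_congr rfl fun R _ => ?_
        rw [Finset.inter_comm, ← Finset.sum_ite_mem, Finset.mul_sum]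
        exact Finset.sum_congr rfl fun e _ => by split_ifs <;> simp
    _ ≤ _ := Finset.sum_le_sum fun R _ =>
        mul_le_mul_of_nonneg_left (hf.sum_le _ i) (activeProb_nonneg hp R)

/-- If `N` elements of `S` are active, monotonicity gives at least the average of their singleton
values. The factor `1 / N` is replaced by its tangent `2 / y - N / y ^ 2` at `y`, which leaves only
first and second moments. -/
theorem sum_div_le_nonadap (hp : ∀ e, p e ∈ Set.Icc (0 : ℝ) 1) (hf : IsMaxOfSums a f)
    (σ : List (Fin n)) {S : Finset (Fin n)} (hS : S ⊆ σ.toFinset) :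
    (∑ e ∈ S, p e * f {e}) / (1 + ∑ e ∈ S, p e) ≤ nonadap p f σ := by
  rw [nonadap_eq hf]
  set y := 1 + ∑ e ∈ S, p e with hy
  have hy0 : 0 < y := by
    have := Finset.sum_nonneg fun e (_ : e ∈ S) => (hp e).1
    linarith
  have key : ∀ R, (∑ e ∈ S, if e ∈ R then f {e} else 0)
      * (2 / y - (∑ e ∈ S, if e ∈ R then 1 else 0) / y ^ 2) ≤ f (R ∩ σ.toFinset) := by
    intro R
    set B := f (R ∩ σ.toFinset)
    set N : ℝ := ∑ e ∈ S, if e ∈ R then 1 else 0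
    have hB : 0 ≤ B := hf.nonneg _
    have h1 : (∑ e ∈ S, if e ∈ R then f {e} else 0) ≤ N * B := by
      rw [Finset.sum_mul]
      refine Finset.sum_le_sum fun e he => ?_
      split_ifs with h
      · rw [one_mul]
        refine hf.mono ?_
        simpa [h] using hS he
      · simp
    have h0 : 0 ≤ ∑ e ∈ S, if e ∈ R then f {e} else 0 :=
      Finset.sum_nonneg fun e _ => by split_ifs <;> simp [hf.nonneg]
    have h2 : N * (2 / y - N / y ^ 2) ≤ 1 := by
      have : 1 - N * (2 / y - N / y ^ 2) = (1 - N / y) ^ 2 := by field_simp; ring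
      nlinarith [sq_nonneg (1 - N / y)]
    -- Where the tangent is negative, the left side is at most zero and the bound is trivial.
    rcases le_total 0 (2 / y - N / y ^ 2) with h | h
    · nlinarith [mul_le_mul_of_nonneg_right h1 h]
    · nlinarith [mul_nonneg_of_nonpos_of_nonpos h (neg_nonpos.2 h0)]
  refine le_trans ?_ (Finset.sum_le_sum fun R _ =>
    mul_le_mul_of_nonneg_left (key R) (activeProb_nonneg hp R))
  -- The expected number of active elements of `S`, restricted to the event that `e` is active, is
  -- at most `p e * y`; the 1 in `y` accounts for `e` itself.
  have hpair : ∀ e ∈ S, ∑ e' ∈ S, ∏ x ∈ ({e, e'} : Finset (Fin n)), p x ≤ p e * y := by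
    intro e he
    calc ∑ e' ∈ S, ∏ x ∈ ({e, e'} : Finset (Fin n)), p x
        ≤ ∑ e' ∈ S, (p e * p e' + if e = e' then p e else 0) := by
          refine Finset.sum_le_sum fun e' _ => ?_
          by_cases h : e = e'
          · subst h
            simpa using mul_nonneg (hp e).1 (hp e).1
          · simp [h, Finset.prod_pair h]
      _ = p e * y := by
          rw [Finset.sum_add_distrib, ← Finset.mul_sum, Finset.sum_ite_eq, if_pos he, hy]
          ring
  have expand : ∑ R, activeProb p R * ((∑ e ∈ S, if e ∈ R then f {e} else 0)
      * (2 / y - (∑ e ∈ S, if e ∈ R then 1 else 0) / y ^ 2))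
      = ∑ e ∈ S, f {e} * (2 / y * p e
        - (∑ e' ∈ S, ∏ x ∈ ({e, e'} : Finset (Fin n)), p x) / y ^ 2) := by
    have swap : ∀ e, ∑ e' ∈ S, ∏ x ∈ ({e, e'} : Finset (Fin n)), p x
        = ∑ R : Finset (Fin n), activeProb p R *
          ((if e ∈ R then 1 else 0) * ∑ e' ∈ S, if e' ∈ R then 1 else 0) := fun e => by
      simp only [← sum_activeProb_pair_mem, Finset.mul_sum]
      exact Finset.sum_comm
    have collect : ∀ e, f {e} * (2 / y * p e
        - (∑ e' ∈ S, ∏ x ∈ ({e, e'} : Finset (Fin n)), p x) / y ^ 2)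
        = ∑ R : Finset (Fin n), activeProb p R * ((if e ∈ R then f {e} else 0)
          * (2 / y - (∑ e' ∈ S, if e' ∈ R then 1 else 0) / y ^ 2)) := fun e => by
      rw [swap]
      nth_rewrite 1 [← sum_activeProb_mem p e]
      rw [Finset.mul_sum, Finset.sum_div, ← Finset.sum_sub_distrib, Finset.mul_sum]
      refine Finset.sum_congr rfl fun R _ => ?_
      split_ifs <;> ring
    simp only [collect]
    rw [Finset.sum_comm]
    refine Finset.sum_congr rfl fun R _ => ?_
    rw [Finset.sum_mul, Finset.mul_sum]
  rw [expand, Finset.sum_div]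
  refine Finset.sum_le_sum fun e he => ?_
  have h1 := hpair e he
  have h2 : (∑ e' ∈ S, ∏ x ∈ ({e, e'} : Finset (Fin n)), p x) / y ^ 2 ≤ p e / y := by
    rw [div_le_div_iff₀ (by positivity) hy0]
    nlinarith
  have h3 : p e * f {e} / y = f {e} * (2 / y * p e - p e / y) := by field_simp; ring
  rw [h3]
  exact mul_le_mul_of_nonneg_left (by linarith) (hf.nonneg _)

end NonAdaptive

/-! ### Combining the bounds -/

/-- The linear function that counts the elements of value at least `t`. -/
noncomputable def largeWeight (p : Fin n → ℝ) (f : Finset (Fin n) → ℝ) (t : ℝ) (e : Fin n) : ℝ :=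
  if t ≤ f {e} then p e * f {e} else 0

/-- The activation probabilities of the elements of value at least `t`. -/
noncomputable def largeProb (p : Fin n → ℝ) (f : Finset (Fin n) → ℝ) (t : ℝ) (e : Fin n) : ℝ :=
  if t ≤ f {e} then p e else 0

theorem largeWeight_nonneg {p : Fin n → ℝ} {a : Fin W → Fin n → ℝ} {f : Finset (Fin n) → ℝ}
    (hp : ∀ e, p e ∈ Set.Icc (0 : ℝ) 1) (hf : IsMaxOfSums a f) (t : ℝ) (e : Fin n) :
    0 ≤ largeWeight p f t e := by
  unfold largeWeight
  split_ifs
  exacts [mul_nonneg (hp e).1 (hf.nonneg _), le_rfl]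

/-- The score of the oracle's answer to the query `c`. -/
noncomputable def score (O : (Fin n → ℝ) → List (Fin n)) (c q : Fin n → ℝ) : ℝ :=
  ((O c).map c).sum / (1 + ((O c).map q).sum)

section Combine

variable {p : Fin n → ℝ} {a : Fin W → Fin n → ℝ} {f : Finset (Fin n) → ℝ}
  {F : Set (List (Fin n))} {O : (Fin n → ℝ) → List (Fin n)}

theorem score_eq (hF : IsPrefixClosed F) (hO : IsLinearOracle F O) {c : Fin n → ℝ}
    (hc : ∀ e, 0 ≤ c e) (q : Fin n → ℝ) :
    score O c q = (∑ e ∈ (O c).toFinset, c e) / (1 + ∑ e ∈ (O c).toFinset, q e) := by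
  have := hF.nodup _ (hO c hc).1
  rw [score, List.sum_toFinset _ this, List.sum_toFinset _ this]

theorem score_zero_le_nonadap (hp : ∀ e, p e ∈ Set.Icc (0 : ℝ) 1) (hf : IsMaxOfSums a f)
    (hF : IsPrefixClosed F) (hO : IsLinearOracle F O) (i : Fin W) :
    score O (fun e => p e * a i e) (fun _ => 0) ≤ nonadap p f (O fun e => p e * a i e) := by
  rw [score_eq hF hO fun e => mul_nonneg (hp e).1 (hf.coeff_nonneg i e)]
  simpa using sum_le_nonadap hp hf _ i

theorem score_large_le_nonadap (hp : ∀ e, p e ∈ Set.Icc (0 : ℝ) 1) (hf : IsMaxOfSums a f)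
    (hF : IsPrefixClosed F) (hO : IsLinearOracle F O) (t : ℝ) :
    score O (largeWeight p f t) (largeProb p f t) ≤ nonadap p f (O (largeWeight p f t)) := by
  rw [score_eq hF hO (largeWeight_nonneg hp hf t)]
  simpa only [Finset.sum_filter, largeWeight, largeProb] using sum_div_le_nonadap hp hf (O (largeWeight p f t))
    (Finset.filter_subset (fun e => t ≤ f {e}) (O (largeWeight p f t)).toFinset)

/-- Each large element contributes at least `t` times its probability, so the total `L` and the
total probability `P` satisfy `t * P ≤ L`. With `z = min L t` this gives `z * (1 + P) ≤ 2 * L`. -/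
theorem half_min_le_score (hp : ∀ e, p e ∈ Set.Icc (0 : ℝ) 1) (hf : IsMaxOfSums a f)
    (hF : IsPrefixClosed F) (hO : IsLinearOracle F O) {t : ℝ} (ht : 0 ≤ t) :
    min (∑ e ∈ (O (largeWeight p f t)).toFinset, largeWeight p f t e) t / 2
      ≤ score O (largeWeight p f t) (largeProb p f t) := by
  rw [score_eq hF hO (largeWeight_nonneg hp hf t)]
  set S := (O (largeWeight p f t)).toFinset
  have hP : 0 ≤ ∑ e ∈ S, largeProb p f t e := Finset.sum_nonneg fun e _ => by
    unfold largeProb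
    split_ifs
    exacts [(hp e).1, le_rfl]
  have hL : t * ∑ e ∈ S, largeProb p f t e ≤ ∑ e ∈ S, largeWeight p f t e := by
    rw [Finset.mul_sum]
    refine Finset.sum_le_sum fun e _ => ?_
    unfold largeProb largeWeight
    split_ifs with h
    · nlinarith [(hp e).1]
    · simp
  set P := ∑ e ∈ S, largeProb p f t e
  set L := ∑ e ∈ S, largeWeight p f t e
  rw [div_le_div_iff₀ two_pos (by linarith)]
  have h1 := min_le_left L t
  have h2 := min_le_right L t
  have h3 : 0 ≤ min L t := le_min ((mul_nonneg ht hP).trans hL) ht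
  nlinarith

/-- Either `M` alone is large enough, or a multiple of `M` within a factor 2 below `m / (4 ℓ)` makes
`t log W` and `2 M` at most `m / 4` each, leaving `L ≥ m / 2`. -/
theorem adap_le_of_scores (hp : ∀ e, p e ∈ Set.Icc (0 : ℝ) 1) (hf : IsMaxOfSums a f)
    (hF : IsPrefixClosed F) (hO : IsLinearOracle F O) {M V : ℝ} (hM0 : 0 ≤ M) (hMV : M ≤ V)
    (hM : ∀ i, score O (fun e => p e * a i e) (fun _ => 0) ≤ M)
    (hV : ∀ k < W, score O (largeWeight p f ((k + 1 : ℕ) * M)) (largeProb p f ((k + 1 : ℕ) * M)) ≤ V)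
    {T : StrategyTree n} (hT : T.Feasible F) : adap p f T ≤ 16 * (1 + Real.log W) * V := by
  have hMF : ∀ i, ∀ τ ∈ F, ∑ e ∈ τ.toFinset, p e * a i e ≤ M := by
    intro i τ hτ
    have hc : ∀ e, 0 ≤ p e * a i e := fun e => mul_nonneg (hp e).1 (hf.coeff_nonneg i e)
    have := hM i
    rw [score_eq hF hO hc] at this
    exact ((hO _ hc).2 τ hτ).trans (by simpa using this)
  set m := adap p f T
  have hmW : m ≤ W * M := adap_le_width_mul hp hf hF hMF hT
  have hlog : 0 ≤ Real.log W := Real.log_natCast_nonneg W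
  set ℓ := 1 + Real.log W with hℓ
  have hV0 : 0 ≤ V := hM0.trans hMV
  by_cases hsmall : m ≤ 8 * ℓ * M
  · refine hsmall.trans ?_
    have : ℓ * M ≤ ℓ * V := mul_le_mul_of_nonneg_left hMV (by linarith)
    nlinarith [mul_nonneg (show 0 ≤ ℓ by linarith) hV0]
  push Not at hsmall
  have hMpos : 0 < M := by
    rcases hM0.eq_or_lt with h | h
    · rw [← h] at hmW hsmall; linarith
    · exact h
  have hm : 0 < m := lt_of_le_of_lt (by positivity) hsmall
  -- The ideal threshold in units of `M`; since it is at least 2, rounding down loses at most a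
  -- factor 2.
  set x := m / (4 * ℓ * M) with hx
  have hℓM : 0 < 4 * ℓ * M := by positivity
  have hx2 : 2 ≤ x := by
    rw [hx, le_div_iff₀ hℓM]; linarith
  have hxm : x * M * (4 * ℓ) = m := by
    rw [hx]
    have : ℓ ≠ 0 := by linarith
    field_simp
  have hxW : x ≤ W := by
    have h1 : x * M * 1 ≤ x * M * (4 * ℓ) :=
      mul_le_mul_of_nonneg_left (by linarith) (by positivity)
    nlinarith
  obtain ⟨k, hk⟩ : ∃ k, ⌊x⌋₊ = k + 1 :=
    Nat.exists_eq_succ_of_ne_zero (Nat.floor_pos.2 (by linarith)).ne'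
  have hk1 : ((k + 1 : ℕ) : ℝ) ≤ x := hk ▸ Nat.floor_le (by linarith)
  have hk2 : x < ((k + 1 : ℕ) : ℝ) + 1 := hk ▸ Nat.lt_floor_add_one x
  have hkW : k < W := by
    have : ((k + 1 : ℕ) : ℝ) ≤ W := hk1.trans hxW
    exact_mod_cast this
  set t := ((k + 1 : ℕ) : ℝ) * M with ht
  have ht0 : 0 < t := by positivity
  have htm : t * (4 * ℓ) ≤ m := by
    rw [← hxm]
    exact mul_le_mul_of_nonneg_right (mul_le_mul_of_nonneg_right hk1 hM0) (by linarith)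
  have htm' : m ≤ t * (8 * ℓ) := by
    have : x * M ≤ 2 * t := by
      rw [ht, ← mul_assoc]
      exact mul_le_mul_of_nonneg_right (by linarith) hM0
    rw [← hxm]
    nlinarith
  have hL := adap_le_of_threshold hp hf hF ht0 hMF
    (fun τ hτ => (hO (largeWeight p f t) (largeWeight_nonneg hp hf t)).2 τ hτ) hT
  have hscore := (half_min_le_score hp hf hF hO ht0.le).trans (hV k hkW)
  set L := ∑ e ∈ (O (largeWeight p f t)).toFinset, largeWeight p f t e
  have h1 : t * Real.log W ≤ m / 4 := by nlinarith
  have h2 : 2 * M ≤ m / 4 := by nlinarith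
  have hL' : m / 2 ≤ L := by linarith
  have h3 : m ≤ 8 * ℓ * min L t := by
    rcases min_choice L t with h | h <;> rw [h]
    · nlinarith
    · linarith
  nlinarith

end Combine

/-! ### Reasoning about programs -/

namespace State

variable (s : State n)

@[simp] theorem tick_I (k : ℕ) : (s.tick k).I = s.I := rfl
@[simp] theorem tick_R (k : ℕ) : (s.tick k).R = s.R := rfl
@[simp] theorem tick_queries (k : ℕ) : (s.tick k).queries = s.queries := rfl
@[simp] theorem tick_time (k : ℕ) : (s.tick k).time = s.time + k := rfl
@[simp] theorem writeI_R (r c x : ℕ) : (s.writeI r c x).R = s.R := rfl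
@[simp] theorem writeI_queries (r c x : ℕ) : (s.writeI r c x).queries = s.queries := rfl
@[simp] theorem writeI_time (r c x : ℕ) : (s.writeI r c x).time = s.time := rfl
@[simp] theorem writeR_I (r c : ℕ) (x : ℝ) : (s.writeR r c x).I = s.I := rfl
@[simp] theorem writeR_queries (r c : ℕ) (x : ℝ) : (s.writeR r c x).queries = s.queries := rfl
@[simp] theorem writeR_time (r c : ℕ) (x : ℝ) : (s.writeR r c x).time = s.time := rfl

@[simp] theorem writeI_I (r c x r' c' : ℕ) :
    (s.writeI r c x).I r' c' = if r' = r ∧ c' = c then x else s.I r' c' := by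
  by_cases hr : r' = r
  · subst hr; by_cases hc : c' = c <;> simp [writeI, hc]
  · simp [writeI, hr]

@[simp] theorem writeR_R (r c : ℕ) (x : ℝ) (r' c' : ℕ) :
    (s.writeR r c x).R r' c' = if r' = r ∧ c' = c then x else s.R r' c' := by
  by_cases hr : r' = r
  · subst hr; by_cases hc : c' = c <;> simp [writeR, hc]
  · simp [writeR, hr]

variable (O : (Fin n → ℝ) → List (Fin n)) (r d : ℕ)

@[simp] theorem ask_R : (s.ask O r d).R = s.R := rfl
@[simp] theorem ask_time : (s.ask O r d).time = s.time := rfl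
@[simp] theorem ask_queries : (s.ask O r d).queries = s.queries ++ [fun e : Fin n => s.R r e] := rfl

theorem ask_I_of_ne {d' : ℕ} (h : d' ≠ d) : (s.ask O r d).I d' = s.I d' := by
  simp [ask, writeList, h]

theorem ask_I_zero : (s.ask O r d).I d 0 = (O fun e => s.R r e).length := by
  simp [ask, writeList]

theorem ask_I_succ {j : ℕ} (hj : j < (O fun e => s.R r e).length) :
    (s.ask O r d).I d (j + 1) = (O fun e => s.R r e)[j] := by
  simp [ask, writeList, hj]

end State

/-- Running `P` from `s` takes at most `T` steps and leads to memory contents and queries that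
satisfy `B`. -/
def Reaches (O : (Fin n → ℝ) → List (Fin n)) (P : Program) (s : State n) (T : ℕ)
    (B : (ℕ → ℕ → ℕ) → (ℕ → ℕ → ℝ) → List (Fin n → ℝ) → Prop) : Prop :=
  (P.exec O s).time ≤ s.time + T ∧ B (P.exec O s).I (P.exec O s).R (P.exec O s).queries

namespace Reaches

variable {O : (Fin n → ℝ) → List (Fin n)} {P Q : Program} {s : State n} {T T' : ℕ}
  {B C : (ℕ → ℕ → ℕ) → (ℕ → ℕ → ℝ) → List (Fin n → ℝ) → Prop}

theorem mono (h : Reaches O P s T B) (hT : T ≤ T') (hBC : ∀ I R q, B I R q → C I R q) :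
    Reaches O P s T' C :=
  ⟨h.1.trans (by omega), hBC _ _ _ h.2⟩

theorem seq (h : Reaches O P s T B)
    (h' : ∀ u : State n, B u.I u.R u.queries → Reaches O Q u T' C) :
    Reaches O (.seq P Q) s (T + T') C := by
  have := h' _ h.2
  exact ⟨by have h1 := h.1; have h2 := this.1; simp only [Program.exec]; omega, this.2⟩

/-- The iteration count is read once on entry, so `P` may overwrite the cells from which it was
computed. -/
theorem loop {k : IExp} {N : ℕ} (inv : ℕ → (ℕ → ℕ → ℕ) → (ℕ → ℕ → ℝ) → List (Fin n → ℝ) → Prop)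
    (hk : k.eval s = N) (h0 : inv 0 s.I s.R s.queries)
    (hstep : ∀ j < N, ∀ u : State n, inv j u.I u.R u.queries → Reaches O P u T (inv (j + 1))) :
    Reaches O (.loop k P) s (k.cost + 1 + N * (T + 1)) (inv N) := by
  have key : ∀ j ≤ N, ((fun u => (P.exec O u).tick 1)^[j] (s.tick (k.cost + 1))).time
      ≤ s.time + (k.cost + 1 + j * (T + 1)) ∧
      inv j ((fun u => (P.exec O u).tick 1)^[j] (s.tick (k.cost + 1))).I
        ((fun u => (P.exec O u).tick 1)^[j] (s.tick (k.cost + 1))).R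
        ((fun u => (P.exec O u).tick 1)^[j] (s.tick (k.cost + 1))).queries := by
    intro j
    induction j with
    | zero => intro _; exact ⟨by simp, h0⟩
    | succ j ih =>
      intro hj
      obtain ⟨h1, h2⟩ := ih (by omega)
      have h3 := hstep j (by omega) _ h2
      rw [Function.iterate_succ_apply']
      refine ⟨?_, h3.2⟩
      have := h3.1
      rw [State.tick_time, add_mul j]
      omega
  have := key N le_rfl
  rw [← hk] at this ⊢
  exact this

theorem setI {r c x : IExp} (hB : B (s.writeI (r.eval s) (c.eval s) (x.eval s)).I s.R s.queries) :
    Reaches O (.setI r c x) s (r.cost + c.cost + x.cost + 1) B :=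
  ⟨le_rfl, hB⟩

theorem setR {r c : IExp} {x : RExp}
    (hB : B s.I (s.writeR (r.eval s) (c.eval s) (x.eval s)).R s.queries) :
    Reaches O (.setR r c x) s (r.cost + c.cost + x.cost + 1) B :=
  ⟨le_rfl, hB⟩

theorem query {r d : IExp} (hB : B (s.ask O (r.eval s) (d.eval s)).I s.R
    (s.queries ++ [fun e : Fin n => s.R (r.eval s) e])) :
    Reaches O (.query r d) s (r.cost + d.cost + n + 1) B :=
  ⟨by simp [Program.exec], hB⟩

theorem skip (hB : B s.I s.R s.queries) : Reaches O .skip s 1 B :=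
  ⟨le_rfl, hB⟩

theorem ite {t : Test} (hpos : t.Holds s → Reaches O P (s.tick (t.cost + 1)) T B)
    (hneg : ¬ t.Holds s → Reaches O Q (s.tick (t.cost + 1)) T' B) :
    Reaches O (.ite t P Q) s (t.cost + 1 + max T T') B := by
  by_cases h : t.Holds s
  · have := hpos h
    exact ⟨by have := this.1; simp only [Program.exec, if_pos h, State.tick_time] at *; omega,
      by simpa only [Program.exec, if_pos h] using this.2⟩
  · have := hneg h
    exact ⟨by have := this.1; simp only [Program.exec, if_neg h, State.tick_time] at *; omega,
      by simpa only [Program.exec, if_neg h] using this.2⟩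

theorem setI_seq {r c x : IExp}
    (h : Reaches O Q ((s.writeI (r.eval s) (c.eval s) (x.eval s)).tick
      (r.cost + c.cost + x.cost + 1)) T B) :
    Reaches O (.seq (.setI r c x) Q) s (r.cost + c.cost + x.cost + 1 + T) B :=
  ⟨by simpa [Program.exec, add_assoc] using h.1, h.2⟩

theorem setR_seq {r c : IExp} {x : RExp}
    (h : Reaches O Q ((s.writeR (r.eval s) (c.eval s) (x.eval s)).tick
      (r.cost + c.cost + x.cost + 1)) T B) :
    Reaches O (.seq (.setR r c x) Q) s (r.cost + c.cost + x.cost + 1 + T) B :=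
  ⟨by simpa [Program.exec, add_assoc] using h.1, h.2⟩

theorem query_seq {r d : IExp}
    (h : Reaches O Q ((s.ask O (r.eval s) (d.eval s)).tick (r.cost + d.cost + n + 1)) T B) :
    Reaches O (.seq (.query r d) Q) s (r.cost + d.cost + n + 1 + T) B :=
  ⟨by simpa [Program.exec, add_assoc] using h.1, h.2⟩

end Reaches

/-! ### The program

Row `0` of the index memory holds `n`, `W`, an outer and an inner loop counter, the row that is
currently used for a query, and the row of the best query so far. Row `W + 1` of the real memory
holds the best score, two accumulators, the threshold and its increment; row `W + 2` holds the
values `f {e}`. From row `W + 3` on, two consecutive rows are used for each query. -/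

/-- The `k`-th index register. -/
def reg (k : ℕ) : IExp := .cell (.const 0) (.const k)

def setReg (k : ℕ) (x : IExp) : Program := .setI (.const 0) (.const k) x

def scalarRow : IExp := .add (reg 1) (.const 1)

def valueRow : IExp := .add (reg 1) (.const 2)

/-- The `k`-th real register. -/
def scalar (k : ℕ) : RExp := .cell scalarRow (.const k)

def setScalar (k : ℕ) (x : RExp) : Program := .setR scalarRow (.const k) x

def incr (k m : ℕ) : Program := setReg k (.add (reg k) (.const m))

/-- Add the two weights of the next element of the oracle's answer to the accumulators. -/
def accumulate : Program :=
  .seq (incr 3 1) <|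
  .seq (setScalar 1 (.add (scalar 1) (.cell (reg 4) (.cell (.const 2) (reg 3)))))
    (setScalar 2 (.add (scalar 2) (.cell (.add (reg 4) (.const 1)) (.cell (.const 2) (reg 3)))))

def currentScore : RExp := .div (scalar 1) (.add (.const 1) (scalar 2))

/-- Query the oracle with the current row, compute the score of its answer, and make the row the
best one if its score is at least the best score. -/
def evaluate : Program :=
  .seq (.query (reg 4) (.const 2)) <|
  .seq (setReg 3 (.const 0)) <|
  .seq (setScalar 1 (.const 0)) <|
  .seq (setScalar 2 (.const 0)) <|
  .seq (.loop (.cell (.const 2) (.const 0)) accumulate)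
    (.ite (.rle (scalar 0) currentScore)
      (.seq (setScalar 0 currentScore) (setReg 5 (reg 4))) .skip)

/-- The counter is advanced before reading because column 0 of the answer row holds its length.
Query rows start at `W + 3`, so writing the accumulators does not disturb the weights. -/
theorem reaches_accumulate {O : (Fin n → ℝ) → List (Fin n)} {s : State n} (hW : s.I 0 1 = W)
    (hr : W + 3 ≤ s.I 0 4) :
    Reaches O accumulate s 60 fun I R q =>
      (∀ r c, I r c = if r = 0 ∧ c = 3 then s.I 0 3 + 1 else s.I r c) ∧
      (∀ r c, R r c = if r = W + 1 ∧ c = 1 then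
          s.R (W + 1) 1 + s.R (s.I 0 4) (s.I 2 (s.I 0 3 + 1))
        else if r = W + 1 ∧ c = 2 then
          s.R (W + 1) 2 + s.R (s.I 0 4 + 1) (s.I 2 (s.I 0 3 + 1))
        else s.R r c) ∧ q = s.queries := by
  have h5 : s.I 0 4 ≠ W := by omega
  refine ⟨?_, ?_, ?_, rfl⟩
  · simp [accumulate, incr, setReg, setScalar, reg, scalar, scalarRow, Program.exec, IExp.cost,
      RExp.cost, add_assoc]
  · intro r c
    simp [accumulate, incr, setReg, setScalar, reg, Program.exec, IExp.eval]
  · intro r c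
    simp [accumulate, incr, setReg, setScalar, reg, scalar, scalarRow, Program.exec, IExp.eval,
      RExp.eval, hW, h5]
    split_ifs <;> first | rfl | omega

theorem reaches_evaluate {O : (Fin n → ℝ) → List (Fin n)} {s : State n} {c q : Fin n → ℝ}
    (hW : s.I 0 1 = W) (hr : W + 3 ≤ s.I 0 4) (hc : ∀ e : Fin n, s.R (s.I 0 4) e = c e)
    (hq : ∀ e : Fin n, s.R (s.I 0 4 + 1) e = q e) (hlen : (O c).length ≤ n) :
    Reaches O evaluate s (200 * (n + 1)) fun I R qs =>
      (∀ k, k ≠ 3 → k ≠ 5 → I 0 k = s.I 0 k) ∧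
      (∀ r c, ¬ (r = W + 1 ∧ c < 3) → R r c = s.R r c) ∧
      R (W + 1) 0 = max (s.R (W + 1) 0) (score O c q) ∧
      I 0 5 = (if s.R (W + 1) 0 ≤ score O c q then s.I 0 4 else s.I 0 5) ∧
      qs = s.queries ++ [c] := by
  have hc' : (fun e : Fin n => s.R (s.I 0 4) e) = c := funext hc
  -- After `j` iterations the accumulators hold both weights of the first `j` elements of the
  -- answer.
  let inv : ℕ → (ℕ → ℕ → ℕ) → (ℕ → ℕ → ℝ) → List (Fin n → ℝ) → Prop := fun j I R qs =>
    I 0 3 = j ∧ (∀ k, k ≠ 3 → I 0 k = s.I 0 k) ∧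
    (∀ j (h : j < (O c).length), I 2 (j + 1) = (O c)[j]) ∧
    (∀ r c, ¬ (r = W + 1 ∧ (c = 1 ∨ c = 2)) → R r c = s.R r c) ∧
    R (W + 1) 1 = (((O c).take j).map c).sum ∧ R (W + 1) 2 = (((O c).take j).map q).sum ∧
    qs = s.queries ++ [c]
  refine Reaches.mono (Reaches.query_seq <| Reaches.setI_seq <| Reaches.setR_seq <|
    Reaches.setR_seq <| Reaches.seq (T' := 100) (Reaches.loop inv (N := (O c).length) (T := 60)
      ?_ ?_ ?_) ?_) ?_ fun I R q h => h
  · simp [reg, IExp.eval, hc', State.ask_I_zero]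
  · refine ⟨?_, ?_, ?_, ?_, ?_, ?_, ?_⟩
    · simp [IExp.eval]
    · intro k hk
      simp [IExp.eval, hk, State.ask_I_of_ne]
    · intro j hj
      have := s.ask_I_succ O (s.I 0 4) 2 (j := j) (by rwa [hc'])
      simpa [IExp.eval, reg, hc'] using this
    · intro r c hrc
      simp only [not_and, not_or] at hrc
      simp [IExp.eval, scalarRow, reg, RExp.eval, State.ask_I_of_ne, hW]
      grind
    · simp [IExp.eval, scalarRow, reg, RExp.eval, State.ask_I_of_ne, hW]
    · simp [IExp.eval, scalarRow, reg, RExp.eval, State.ask_I_of_ne, hW]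
    · simp [IExp.eval, reg, hc']
  · rintro j hj u ⟨h1, h2, h3, h4, h5, h6, h7⟩
    refine (reaches_accumulate (W := W) (by rw [h2 1 (by simp), hW])
      (by rwa [h2 4 (by simp)])).mono le_rfl ?_
    rintro I R qs ⟨hI, hR, hqs⟩
    have hI2 := h3 j hj
    have e1 : u.R (u.I 0 4) (u.I 2 (u.I 0 3 + 1)) = c (O c)[j] := by
      rw [h1, hI2, h2 4 (by simp), h4 _ _ (by omega), hc]
    have e2 : u.R (u.I 0 4 + 1) (u.I 2 (u.I 0 3 + 1)) = q (O c)[j] := by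
      rw [h1, hI2, h2 4 (by simp), h4 _ _ (by omega), hq]
    rw [e1, e2] at hR
    refine ⟨?_, ?_, ?_, ?_, ?_, ?_, ?_⟩
    · simp [hI, h1]
    · intro k hk
      simp [hI, hk, h2]
    · intro j hj
      simp [hI, h3 j hj]
    · intro r c hrc
      rw [hR, ← h4 r c hrc, if_neg (by tauto), if_neg (by tauto)]
    · rw [hR, if_pos ⟨rfl, rfl⟩, h5, List.take_succ_eq_append_getElem hj, List.map_append,
        List.sum_append, List.map_singleton, List.sum_singleton]
    · rw [hR, if_neg (by simp), if_pos ⟨rfl, rfl⟩, h6, List.take_succ_eq_append_getElem hj,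
        List.map_append, List.sum_append, List.map_singleton, List.sum_singleton]
    · rw [hqs, h7]
  · rintro u ⟨h1, h2, h3, h4, h5, h6, h7⟩
    simp only [List.take_length] at h5 h6
    have hu1 : u.I 0 1 = W := by rw [h2 1 (by simp), hW]
    have hu0 : u.R (W + 1) 0 = s.R (W + 1) 0 := h4 _ _ (by simp)
    have hscore : currentScore.eval u = score O c q := by
      simp [currentScore, scalar, scalarRow, reg, RExp.eval, IExp.eval, hu1, h5, h6, score]
    have hle : (Test.rle (scalar 0) currentScore).Holds u ↔ s.R (W + 1) 0 ≤ score O c q := by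
      simp [Test.Holds, hscore, scalar, scalarRow, reg, RExp.eval, IExp.eval, hu1, hu0]
    refine Reaches.mono (Reaches.ite (T := 40) (T' := 1) (fun ht => ?_)
      (fun ht => Reaches.skip ?_)) (T' := 100) ?_ fun I R q h => h
    · rw [hle] at ht
      refine Reaches.mono (Reaches.setR_seq <| Reaches.setI ?_) ?_ fun I R q h => h
      swap
      · simp [IExp.cost, RExp.cost, currentScore, scalar, scalarRow, reg]
      refine ⟨?_, ?_, ?_, ?_, ?_⟩
      · intro k hk3 hk5
        simp [IExp.eval, hk5, h2 k hk3]
      · intro r c hrc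
        have : ¬ (r = W + 1 ∧ c = 0) := by rintro ⟨rfl, rfl⟩; simp at hrc
        simp only [scalarRow, reg, IExp.eval, State.tick_I, State.tick_R, State.writeR_R, hu1,
          if_neg this]
        exact h4 r c fun h => hrc ⟨h.1, by omega⟩
      · have : currentScore.eval (u.tick ((Test.rle (scalar 0) currentScore).cost + 1))
            = score O c q := hscore
        simp [this, scalarRow, reg, IExp.eval, hu1, ht]
      · simp [IExp.eval, reg, ht, h2]
      · simp [h7]
    · rw [hle] at ht
      refine ⟨fun k hk3 _ => h2 k hk3, ?_, ?_, ?_, h7⟩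
      · intro r c hrc
        exact h4 r c fun h => hrc ⟨h.1, by omega⟩
      · rw [State.tick_R, hu0, max_eq_left (not_le.1 ht).le]
      · simp [ht, h2]
    · simp [Test.cost, IExp.cost, RExp.cost, currentScore, scalar, scalarRow, reg]
  · simp only [IExp.cost, RExp.cost, reg, scalarRow]
    omega

/-- Run `P` for each element, the inner loop counter holding the element. -/
def forEach (P : Program) : Program :=
  .seq (setReg 3 (.const 0)) (.loop (reg 0) (.seq P (incr 3 1)))

/-- Pass `j` changes real cells in column `j` only, so each pass finds its own column as it was on
entry. -/
theorem reaches_forEach {O : (Fin n → ℝ) → List (Fin n)} {P : Program} {s : State n} {T : ℕ}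
    (G : ℕ → ℕ → ℝ) (hn : s.I 0 0 = n)
    (hP : ∀ j < n, ∀ u : State n,
      (∀ r c, u.I r c = if r = 0 ∧ c = 3 then j else s.I r c) →
      (∀ r c, u.R r c = if c < j then G r c else s.R r c) → u.queries = s.queries →
      Reaches O P u T fun I R q =>
        I = u.I ∧ (∀ r c, R r c = if c = j then G r c else u.R r c) ∧ q = u.queries) :
    Reaches O (forEach P) s (20 + n * (T + 10)) fun I R q =>
      (∀ r c, ¬ (r = 0 ∧ c = 3) → I r c = s.I r c) ∧
      (∀ r c, R r c = if c < n then G r c else s.R r c) ∧ q = s.queries := by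
  let inv : ℕ → (ℕ → ℕ → ℕ) → (ℕ → ℕ → ℝ) → List (Fin n → ℝ) → Prop := fun j I R q =>
    (∀ r c, I r c = if r = 0 ∧ c = 3 then j else s.I r c) ∧
    (∀ r c, R r c = if c < j then G r c else s.R r c) ∧ q = s.queries
  refine Reaches.mono (Reaches.setI_seq <| Reaches.loop inv (N := n) (T := T + 9) ?_ ?_ ?_) ?_ ?_
  · simp [reg, IExp.eval, hn]
  · exact ⟨by simp [IExp.eval], by simp, rfl⟩
  · rintro j hj u ⟨h1, h2, h3⟩
    refine Reaches.mono (Reaches.seq (hP j hj u h1 h2 h3) (T' := 9) ?_) le_rfl fun I R q h => h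
    rintro v ⟨hI, hR, hq⟩
    refine Reaches.mono (Reaches.setI (B := inv (j + 1)) ⟨?_, ?_, ?_⟩) ?_
      fun I R q h => h
    · intro r c
      simp [reg, IExp.eval, hI, h1]
      grind
    · intro r c
      rw [hR, h2]
      grind
    · rw [hq, h3]
    · simp [IExp.cost, reg]
  · simp [IExp.cost, reg]
    nlinarith
  · rintro I R q ⟨h1, h2, h3⟩
    exact ⟨fun r c h => by rw [h1, if_neg h], h2, h3⟩

/-- The coefficient of the current element in the current summand. -/
def coefficient : RExp := .cell (.add (reg 2) (.const 1)) (reg 3)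

/-- Write the expected contribution of the current element to the current summand, and update the
value of the element. -/
def fillSum : Program :=
  .seq (.setR (reg 4) (reg 3) (.mul (.cell (.const 0) (reg 3)) coefficient)) <|
  .seq (.setR (.add (reg 4) (.const 1)) (reg 3) (.const 0)) <|
  .ite (.rle (.cell valueRow (reg 3)) coefficient) (.setR valueRow (reg 3) coefficient) .skip

/-- Write the two weights of the current element that belong to the current threshold. -/
def fillLarge : Program :=
  .ite (.rle (scalar 3) (.cell valueRow (reg 3)))
    (.seq (.setR (reg 4) (reg 3) (.mul (.cell (.const 0) (reg 3)) (.cell valueRow (reg 3))))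
      (.setR (.add (reg 4) (.const 1)) (reg 3) (.cell (.const 0) (reg 3))))
    (.seq (.setR (reg 4) (reg 3) (.const 0))
      (.setR (.add (reg 4) (.const 1)) (reg 3) (.const 0)))

theorem reaches_fillSum {O : (Fin n → ℝ) → List (Fin n)} {s : State n} (hn : s.I 0 0 = n)
    (hW : s.I 0 1 = W) (hi : s.I 0 2 < W) (hr : W + 3 ≤ s.I 0 4) :
    Reaches O (forEach fillSum) s (20 + n * 110) fun I R q =>
      (∀ r c, ¬ (r = 0 ∧ c = 3) → I r c = s.I r c) ∧
      (∀ r c, R r c = if c < n then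
          if r = s.I 0 4 then s.R 0 c * s.R (s.I 0 2 + 1) c
          else if r = s.I 0 4 + 1 then 0
          else if r = W + 2 then max (s.R (W + 2) c) (s.R (s.I 0 2 + 1) c)
          else s.R r c
        else s.R r c) ∧ q = s.queries := by
  refine reaches_forEach (T := 100) (fun r c => if r = s.I 0 4 then s.R 0 c * s.R (s.I 0 2 + 1) c
      else if r = s.I 0 4 + 1 then 0
      else if r = W + 2 then max (s.R (W + 2) c) (s.R (s.I 0 2 + 1) c)
      else s.R r c) hn ?_
  intro j hj u hI hR hq
  have h1 : u.I 0 1 = W := by simp [hI, hW]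
  have h2 : u.I 0 2 = s.I 0 2 := by simp [hI]
  have h3 : u.I 0 3 = j := by simp [hI]
  have h4 : u.I 0 4 = s.I 0 4 := by simp [hI]
  have hj' : ∀ r, u.R r j = s.R r j := fun r => by simp [hR]
  have n1 : s.I 0 2 + 1 ≠ s.I 0 4 := by omega
  have n2 : s.I 0 2 ≠ s.I 0 4 := by omega
  have n3 : W + 2 ≠ s.I 0 4 := by omega
  have n4 : W + 2 ≠ s.I 0 4 + 1 := by omega
  refine Reaches.mono (Reaches.setR_seq <| Reaches.setR_seq <| Reaches.ite
    (T := 20) (T' := 1) (fun ht => ?_) (fun ht => Reaches.skip ?_)) ?_ fun I R q h => h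
  · refine Reaches.mono (Reaches.setR ?_) ?_ fun I R q h => h
    · refine ⟨rfl, fun r c => ?_, rfl⟩
      simp [Test.Holds, coefficient, valueRow, reg, IExp.eval, RExp.eval, h1, h2, h3, h4, hj', n1,
        n2, n3, n4] at ht ⊢
      have := max_eq_right ht
      grind
    · simp [coefficient, valueRow, reg, IExp.cost, RExp.cost]
  · refine ⟨rfl, fun r c => ?_, rfl⟩
    simp [Test.Holds, coefficient, valueRow, reg, IExp.eval, RExp.eval, h1, h2, h3, h4, hj', n1,
        n2, n3, n4] at ht ⊢
    have := max_eq_left ht.le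
    grind
  · simp [Test.cost, coefficient, valueRow, reg, IExp.cost, RExp.cost]

theorem reaches_fillLarge {O : (Fin n → ℝ) → List (Fin n)} {s : State n} (hn : s.I 0 0 = n)
    (hW : s.I 0 1 = W) (hr : W + 3 ≤ s.I 0 4) :
    Reaches O (forEach fillLarge) s (20 + n * 110) fun I R q =>
      (∀ r c, ¬ (r = 0 ∧ c = 3) → I r c = s.I r c) ∧
      (∀ r c, R r c = if c < n then
          if r = s.I 0 4 then
            if s.R (W + 1) 3 ≤ s.R (W + 2) c then s.R 0 c * s.R (W + 2) c else 0
          else if r = s.I 0 4 + 1 then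
            if s.R (W + 1) 3 ≤ s.R (W + 2) c then s.R 0 c else 0
          else s.R r c
        else s.R r c) ∧ q = s.queries := by
  refine reaches_forEach (T := 100) (fun r c => if r = s.I 0 4 then
      if s.R (W + 1) 3 ≤ s.R (W + 2) c then s.R 0 c * s.R (W + 2) c else 0
    else if r = s.I 0 4 + 1 then
      if s.R (W + 1) 3 ≤ s.R (W + 2) c then s.R 0 c else 0
    else s.R r c) hn ?_
  intro j hj u hI hR hq
  have h1 : u.I 0 1 = W := by simp [hI, hW]
  have h3 : u.I 0 3 = j := by simp [hI]
  have h4 : u.I 0 4 = s.I 0 4 := by simp [hI]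
  have hj' : ∀ r, u.R r j = s.R r j := fun r => by simp [hR]
  have n1 : W + 1 ≠ s.I 0 4 := by omega
  have n2 : W + 1 ≠ s.I 0 4 + 1 := by omega
  have n3 : W + 2 ≠ s.I 0 4 := by omega
  have n4 : W + 2 ≠ s.I 0 4 + 1 := by omega
  have n5 : 0 ≠ s.I 0 4 := by omega
  -- The threshold sits in column 3, which may already have been visited; it survives because its
  -- row is not a query row.
  have ht3 : u.R (W + 1) 3 = s.R (W + 1) 3 := by
    rw [hR, if_neg n1, if_neg n2, ite_self]
  have hle : (Test.rle (scalar 3) (.cell valueRow (reg 3))).Holds u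
      ↔ s.R (W + 1) 3 ≤ s.R (W + 2) j := by
    simp [Test.Holds, scalar, scalarRow, valueRow, reg, IExp.eval, RExp.eval, h1, h3, hj', ht3]
  refine Reaches.mono (Reaches.ite (T := 40) (T' := 40) (fun ht => ?_) (fun ht => ?_)) ?_
    fun I R q h => h
  · rw [hle] at ht
    refine Reaches.mono (Reaches.setR_seq <| Reaches.setR ?_) ?_ fun I R q h => h
    · refine ⟨rfl, fun r c => ?_, rfl⟩
      simp [valueRow, reg, IExp.eval, RExp.eval, h1, h3, h4, hj', n5]
      grind
    · simp [valueRow, reg, IExp.cost, RExp.cost]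
  · rw [hle] at ht
    refine Reaches.mono (Reaches.setR_seq <| Reaches.setR ?_) ?_ fun I R q h => h
    · refine ⟨rfl, fun r c => ?_, rfl⟩
      simp [reg, IExp.eval, RExp.eval, h3, h4]
      grind
    · simp [reg, IExp.cost, RExp.cost]
  · simp [Test.cost, scalar, scalarRow, valueRow, reg, IExp.cost, RExp.cost]

/-- Evaluate the current row and move on to a fresh one. -/
def evaluateNext : Program := .seq evaluate (incr 4 2)

/-- One pass of the first phase: the oracle is queried with one of the summands. -/
def sumPass : Program := .seq (forEach fillSum) (.seq (incr 2 1) evaluateNext)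

/-- One pass of the second phase: the threshold is increased, and the oracle is queried with the
contributions of the elements whose value is at least the threshold. -/
def thresholdPass : Program :=
  .seq (setScalar 3 (.add (scalar 3) (scalar 4))) (.seq (forEach fillLarge) evaluateNext)

/-- The approximation algorithm for stochastic probing with max-of-sums objectives. -/
def algorithm : Program :=
  .seq (setReg 4 (.add (reg 1) (.const 3))) <|
  .seq (.loop (reg 1) sumPass) <|
  .seq (setScalar 4 (scalar 0)) <|
  .seq (.loop (reg 1) thresholdPass) <|
  .query (reg 5) (.const 1)

/-- The memory holds the input, and the best row holds weights for which the oracle's answer is at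
least as good as the best score. -/
structure MemoryInvariant (p : Fin n → ℝ) (a : Fin W → Fin n → ℝ) (f : Finset (Fin n) → ℝ)
    (O : (Fin n → ℝ) → List (Fin n)) (I : ℕ → ℕ → ℕ) (R : ℕ → ℕ → ℝ) : Prop where
  size : I 0 0 = n
  width : I 0 1 = W
  row : W + 3 ≤ I 0 4
  prob : ∀ e : Fin n, R 0 e = p e
  coeff : ∀ (i : Fin W) (e : Fin n), R (i + 1) e = a i e
  best_lt : I 0 5 < I 0 4
  best_ne : I 0 5 ≠ W + 1 ∧ I 0 5 ≠ W + 2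
  score_nonneg : 0 ≤ R (W + 1) 0
  score_le : ∃ c : Fin n → ℝ, (∀ e : Fin n, R (I 0 5) e = c e) ∧ (∀ e, 0 ≤ c e) ∧
    R (W + 1) 0 ≤ nonadap p f (O c)

/-! ### Invariants and correctness of the algorithm -/

section Algorithm

variable {p : Fin n → ℝ} {a : Fin W → Fin n → ℝ} {f : Finset (Fin n) → ℝ}
  {F : Set (List (Fin n))} {O : (Fin n → ℝ) → List (Fin n)}

/-- The input rows and the best row lie below the current row and avoid the two working rows, so
scratch work cannot affect them. -/
theorem MemoryInvariant.congr {I I' : ℕ → ℕ → ℕ} {R R' : ℕ → ℕ → ℝ}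
    (h : MemoryInvariant p a f O I R) (hI : ∀ k, k ≠ 2 → k ≠ 3 → I' 0 k = I 0 k)
    (hR : ∀ r c, r < I 0 4 → r ≠ W + 1 → r ≠ W + 2 → R' r c = R r c)
    (h0 : R' (W + 1) 0 = R (W + 1) 0) : MemoryInvariant p a f O I' R' := by
  have hr := h.row
  refine ⟨?_, ?_, ?_, ?_, ?_, ?_, ?_, ?_, ?_⟩
  · rw [hI 0 (by simp) (by simp), h.size]
  · rw [hI 1 (by simp) (by simp), h.width]
  · rwa [hI 4 (by simp) (by simp)]
  · intro e
    rw [hR _ _ (by omega) (by omega) (by omega), h.prob]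
  · intro i e
    have := i.2
    rw [hR _ _ (by omega) (by omega) (by omega), h.coeff]
  · rw [hI 4 (by simp) (by simp), hI 5 (by simp) (by simp)]
    exact h.best_lt
  · rw [hI 5 (by simp) (by simp)]
    exact h.best_ne
  · rw [h0]
    exact h.score_nonneg
  · obtain ⟨c, h1, h2, h3⟩ := h.score_le
    refine ⟨c, fun e => ?_, h2, h0 ▸ h3⟩
    rw [hI 5 (by simp) (by simp), hR _ _ h.best_lt h.best_ne.1 h.best_ne.2, h1]

/-- The hypothesis `hscore` keeps the best score a certified lower bound when the best row changes.
Moving on by two rows protects the stored query. -/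
theorem reaches_evaluateNext {s : State n} (h : MemoryInvariant p a f O s.I s.R)
    {c q : Fin n → ℝ} (hc : ∀ e : Fin n, s.R (s.I 0 4) e = c e)
    (hq : ∀ e : Fin n, s.R (s.I 0 4 + 1) e = q e) (hlen : (O c).length ≤ n) (hc0 : ∀ e, 0 ≤ c e)
    (hscore : score O c q ≤ nonadap p f (O c)) :
    Reaches O evaluateNext s (200 * (n + 1) + 10) fun I R qs =>
      MemoryInvariant p a f O I R ∧ I 0 2 = s.I 0 2 ∧
      (∀ r c, ¬ (r = W + 1 ∧ c < 3) → R r c = s.R r c) ∧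
      R (W + 1) 0 = max (s.R (W + 1) 0) (score O c q) ∧ qs = s.queries ++ [c] := by
  have hr := h.row
  refine Reaches.mono (Reaches.seq (reaches_evaluate h.width h.row hc hq hlen) (T' := 10) ?_) le_rfl
    fun I R q h => h
  rintro u ⟨hI, hR, hbest, hrow, hqs⟩
  refine Reaches.mono (Reaches.setI ?_) ?_ fun I R q h => h
  swap
  · simp [reg, IExp.cost]
  have hv : ∀ k, k ≠ 3 → k ≠ 4 → k ≠ 5 → (u.writeI 0 4 (u.I 0 4 + 2)).I 0 k = s.I 0 k := by
    intro k h3 h4 h5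
    simp [h4, hI k h3 h5]
  have hv4 : (u.writeI 0 4 (u.I 0 4 + 2)).I 0 4 = s.I 0 4 + 2 := by
    simp [hI]
  have hv5 : (u.writeI 0 4 (u.I 0 4 + 2)).I 0 5
      = if s.R (W + 1) 0 ≤ score O c q then s.I 0 4 else s.I 0 5 := by
    simp [hrow]
  have hlt := h.best_lt
  have hne := h.best_ne
  simp only [reg, IExp.eval]
  refine ⟨⟨?_, ?_, ?_, ?_, ?_, ?_, ?_, ?_, ?_⟩, ?_, hR, hbest, hqs⟩
  · rw [hv 0 (by simp) (by simp) (by simp), h.size]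
  · rw [hv 1 (by simp) (by simp) (by simp), h.width]
  · rw [hv4]
    omega
  · intro e
    rw [hR _ _ (by omega), h.prob]
  · intro i e
    have := i.2
    rw [hR _ _ (by omega), h.coeff]
  · rw [hv4, hv5]
    split_ifs <;> omega
  · rw [hv5]
    split_ifs <;> omega
  · rw [hbest]
    exact le_max_of_le_left h.score_nonneg
  · rw [hv5, hbest]
    split_ifs with hle
    · refine ⟨c, fun e => ?_, hc0, ?_⟩
      · rw [hR _ _ (by omega), hc]
      · rwa [max_eq_right hle]
    · obtain ⟨c', h1, h2, h3⟩ := h.score_le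
      refine ⟨c', fun e => ?_, h2, ?_⟩
      · rw [hR _ _ (by omega), h1]
      · rwa [max_eq_left (not_le.1 hle).le]
  · rw [hv 2 (by simp) (by simp) (by simp)]

theorem length_answer_le (hF : IsPrefixClosed F) (hO : IsLinearOracle F O) {c : Fin n → ℝ}
    (hc : ∀ e, 0 ≤ c e) : (O c).length ≤ n := by
  simpa using (hF.nodup _ (hO c hc).1).length_le_card

theorem reaches_incr {s : State n} {k m : ℕ} :
    Reaches O (incr k m) s 10 fun I R q =>
      (∀ l, l ≠ k → I 0 l = s.I 0 l) ∧ I 0 k = s.I 0 k + m ∧ R = s.R ∧ q = s.queries := by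
  refine Reaches.mono (Reaches.setI ⟨fun l hl => ?_, ?_, rfl, rfl⟩) ?_ fun I R q h => h
  · simp [IExp.cost, reg]
  · simp [IExp.eval, hl]
  · simp [IExp.eval, reg]

/-- The state of the first phase after `j` passes. -/
structure SumInvariant (p : Fin n → ℝ) (a : Fin W → Fin n → ℝ) (f : Finset (Fin n) → ℝ)
    (O : (Fin n → ℝ) → List (Fin n)) (j : ℕ) (I : ℕ → ℕ → ℕ) (R : ℕ → ℕ → ℝ)
    (qs : List (Fin n → ℝ)) : Prop where
  memory : MemoryInvariant p a f O I R
  counter : I 0 2 = j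
  threshold : R (W + 1) 3 = 0
  value_le : ∀ e : Fin n, R (W + 2) e ≤ f {e}
  le_value : ∀ (i : Fin W) (e : Fin n), (i : ℕ) < j → a i e ≤ R (W + 2) e
  score_le : ∀ i : Fin W, (i : ℕ) < j → score O (fun e => p e * a i e) (fun _ => 0) ≤ R (W + 1) 0
  length : qs.length = j

theorem reaches_sumPass (hp : ∀ e, p e ∈ Set.Icc (0 : ℝ) 1) (hf : IsMaxOfSums a f)
    (hF : IsPrefixClosed F) (hO : IsLinearOracle F O) {j : ℕ} (hj : j < W) {s : State n}
    (h : SumInvariant p a f O j s.I s.R s.queries) :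
    Reaches O sumPass s (400 * (n + 1)) (SumInvariant p a f O (j + 1)) := by
  have hm := h.memory
  have hr := hm.row
  refine Reaches.mono (Reaches.seq (reaches_fillSum hm.size hm.width (by rw [h.counter]; exact hj)
    hm.row) (T' := 200 * (n + 1) + 20) ?_) (by omega) fun I R q h => h
  rintro u ⟨hI, hR, hq⟩
  rw [h.counter] at hR
  have hI4 : u.I 0 4 = s.I 0 4 := hI _ _ (by simp)
  let i : Fin W := ⟨j, hj⟩
  have hrow : ∀ e : Fin n, u.R (u.I 0 4) e = p e * a i e := fun e => by
    rw [hI4, hR, if_pos e.2, if_pos rfl, hm.prob, ← hm.coeff i e]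
  have hrow' : ∀ e : Fin n, u.R (u.I 0 4 + 1) e = 0 := fun e => by
    rw [hI4, hR, if_pos e.2, if_neg (by omega), if_pos rfl]
  have hvalue : ∀ e : Fin n, u.R (W + 2) e = max (s.R (W + 2) e) (a i e) := fun e => by
    rw [hR, if_pos e.2, if_neg (by omega), if_neg (by omega), if_pos rfl, ← hm.coeff i e]
  have hscalar : ∀ c, u.R (W + 1) c = s.R (W + 1) c := fun c => by
    rw [hR]
    split_ifs <;> first | rfl | omega
  have hu : MemoryInvariant p a f O u.I u.R := by
    refine hm.congr (fun k _ h3 => hI _ _ (by simp [h3])) (fun r c h1 _ h3 => ?_) (hscalar 0)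
    rw [hR]
    split_ifs <;> first | rfl | omega
  have hc0 : ∀ e, 0 ≤ p e * a i e := fun e => mul_nonneg (hp e).1 (hf.coeff_nonneg i e)
  refine Reaches.mono (Reaches.seq reaches_incr (T' := 200 * (n + 1) + 10) ?_) (by omega)
    fun I R q h => h
  rintro v ⟨hvI, hvI2, hvR, hvq⟩
  have hv : MemoryInvariant p a f O v.I v.R :=
    hu.congr (fun k h2 _ => hvI k h2) (fun r c _ _ _ => by rw [hvR]) (by rw [hvR])
  refine Reaches.mono (reaches_evaluateNext (c := fun e => p e * a i e) (q := fun _ => 0) hv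
    (fun e => ?_) (fun e => ?_) (length_answer_le hF hO hc0) hc0
    (score_zero_le_nonadap hp hf hF hO i)) le_rfl ?_
  · rw [hvR, hvI 4 (by simp), hrow]
  · rw [hvR, hvI 4 (by simp), hrow']
  rintro I R qs ⟨h1, h2, h3, h4, h5⟩
  rw [hvR, hscalar] at h4
  rw [hvR] at h3
  refine ⟨h1, ?_, ?_, ?_, ?_, ?_, ?_⟩
  · rw [h2, hvI2, hI _ _ (by simp), h.counter]
  · rw [h3 _ _ (by simp), hscalar, h.threshold]
  · intro e
    rw [h3 _ _ (by simp), hvalue]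
    exact max_le (h.value_le e) (hf.coeff_le_singleton i e)
  · intro i' e hi'
    rw [h3 _ _ (by simp), hvalue]
    rcases Nat.lt_succ_iff_lt_or_eq.1 hi' with hlt | heq
    · exact le_max_of_le_left (h.le_value i' e hlt)
    · rw [show i' = i from Fin.ext heq]
      exact le_max_right _ _
  · intro i' hi'
    rw [h4]
    rcases Nat.lt_succ_iff_lt_or_eq.1 hi' with hlt | heq
    · exact le_max_of_le_left (h.score_le i' hlt)
    · rw [show i' = i from Fin.ext heq]
      exact le_max_right _ _
  · rw [h5]
    simp [hvq, hq, h.length]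

/-- The state of the second phase after `k` passes, `M` being the best score of the first phase. -/
structure ThresholdInvariant (p : Fin n → ℝ) (a : Fin W → Fin n → ℝ) (f : Finset (Fin n) → ℝ)
    (O : (Fin n → ℝ) → List (Fin n)) (M : ℝ) (k : ℕ) (I : ℕ → ℕ → ℕ) (R : ℕ → ℕ → ℝ)
    (qs : List (Fin n → ℝ)) : Prop where
  memory : MemoryInvariant p a f O I R
  step : R (W + 1) 4 = M
  threshold : R (W + 1) 3 = k * M
  value : ∀ e : Fin n, R (W + 2) e = f {e}
  le_score : M ≤ R (W + 1) 0
  score_le : ∀ l < k, score O (largeWeight p f ((l + 1 : ℕ) * M))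
    (largeProb p f ((l + 1 : ℕ) * M)) ≤ R (W + 1) 0
  length : qs.length = W + k

/-- The increment precedes the query, so the passes use the thresholds `M, 2M, …, WM`. -/
theorem reaches_thresholdPass (hp : ∀ e, p e ∈ Set.Icc (0 : ℝ) 1) (hf : IsMaxOfSums a f)
    (hF : IsPrefixClosed F) (hO : IsLinearOracle F O) {M : ℝ} {k : ℕ} {s : State n}
    (h : ThresholdInvariant p a f O M k s.I s.R s.queries) :
    Reaches O thresholdPass s (400 * (n + 1)) (ThresholdInvariant p a f O M (k + 1)) := by
  have hm := h.memory
  have hr := hm.row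
  have hW := hm.width
  set t : ℝ := ((k + 1 : ℕ) : ℝ) * M with ht
  have hstep : Reaches O (setScalar 3 (.add (scalar 3) (scalar 4))) s 50 fun I R q =>
      I = s.I ∧ (∀ r c, R r c = if r = W + 1 ∧ c = 3 then t else s.R r c) ∧ q = s.queries := by
    refine Reaches.mono (Reaches.setR ?_) ?_ fun I R q h => h
    · refine ⟨rfl, fun r c => ?_, rfl⟩
      have : s.R (W + 1) 3 + s.R (W + 1) 4 = t := by
        rw [h.threshold, h.step, ht]
        push_cast
        ring
      simp [scalar, scalarRow, reg, IExp.eval, RExp.eval, hW, this]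
    · simp [scalar, scalarRow, reg, IExp.cost, RExp.cost]
  refine Reaches.mono (Reaches.seq hstep (T' := 330 * (n + 1)) ?_) (by omega) fun I R q h => h
  rintro v ⟨hvI, hvR, hvq⟩
  refine Reaches.mono (Reaches.seq (reaches_fillLarge (W := W) (by rw [hvI, hm.size])
    (by rw [hvI, hW]) (by rw [hvI]; exact hr)) (T' := 200 * (n + 1) + 10) ?_) (by omega)
    fun I R q h => h
  rintro u ⟨hI, hR, hq⟩
  rw [hvI] at hI hR
  rw [hvq] at hq
  have hI4 : u.I 0 4 = s.I 0 4 := hI _ _ (by simp)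
  have hv3 : v.R (W + 1) 3 = t := by rw [hvR, if_pos ⟨rfl, rfl⟩]
  have hv2 : ∀ e : Fin n, v.R (W + 2) e = f {e} := fun e => by
    rw [hvR, if_neg (by omega), h.value]
  have hv0 : ∀ e : Fin n, v.R 0 e = p e := fun e => by
    rw [hvR, if_neg (by omega), hm.prob]
  have hrow : ∀ e : Fin n, u.R (u.I 0 4) e = largeWeight p f t e := fun e => by
    rw [hI4, hR, if_pos e.2, if_pos rfl, hv3, hv2, hv0, largeWeight]
  have hrow' : ∀ e : Fin n, u.R (u.I 0 4 + 1) e = largeProb p f t e := fun e => by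
    rw [hI4, hR, if_pos e.2, if_neg (by omega), if_pos rfl, hv3, hv2, hv0, largeProb]
  have huv : ∀ r c, r < s.I 0 4 → u.R r c = v.R r c := fun r c hrlt => by
    rw [hR]
    split_ifs <;> first | rfl | omega
  have hus : ∀ r c, r < s.I 0 4 → ¬ (r = W + 1 ∧ c = 3) → u.R r c = s.R r c :=
    fun r c h1 h2 => by rw [huv r c h1, hvR, if_neg h2]
  have hu : MemoryInvariant p a f O u.I u.R :=
    hm.congr (fun k _ h3 => hI _ _ (by simp [h3])) (fun r c h1 h2 _ => hus r c h1 (by simp [h2]))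
      (hus _ _ (by omega) (by simp))
  have hc0 := largeWeight_nonneg hp hf t
  refine Reaches.mono (reaches_evaluateNext hu hrow hrow' (length_answer_le hF hO hc0) hc0
    (score_large_le_nonadap hp hf hF hO t)) le_rfl ?_
  rintro I R qs ⟨h1, h2, h3, h4, h5⟩
  rw [hus _ _ (by omega) (by simp)] at h4
  refine ⟨h1, ?_, ?_, ?_, ?_, ?_, ?_⟩
  · rw [h3 _ _ (by simp), hus _ _ (by omega) (by simp), h.step]
  · rw [h3 _ _ (by simp), huv _ _ (by omega), hv3]
  · intro e
    rw [h3 _ _ (by simp), hus _ _ (by omega) (by simp), h.value]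
  · rw [h4]
    exact le_max_of_le_left h.le_score
  · intro l hl
    rw [h4]
    rcases Nat.lt_succ_iff_lt_or_eq.1 hl with hlt | rfl
    · exact le_max_of_le_left (h.score_le l hlt)
    · exact le_max_right _ _
  · rw [h5]
    simp [hq, h.length, add_assoc]

theorem SumInvariant.init (hp : ∀ e, p e ∈ Set.Icc (0 : ℝ) 1) (hf : IsMaxOfSums a f) {I : ℕ → ℕ → ℕ}
    (hI : ∀ r c, I r c = if r = 0 ∧ c = 4 then W + 3 else (State.init p a).I r c) :
    SumInvariant p a f O 0 I (State.init p a).R (State.init p a).queries := by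
  have hzero : ∀ r c, W < r → (State.init p a).R r c = 0 := by
    intro r c hr
    obtain ⟨i, rfl⟩ := Nat.exists_eq_succ_of_ne_zero (by omega : r ≠ 0)
    simp only [State.init]
    split_ifs <;> first | rfl | omega
  refine ⟨⟨?_, ?_, ?_, ?_, ?_, ?_, ?_, ?_, ?_⟩, ?_, ?_, ?_, ?_, ?_, ?_⟩
  · simp [hI, State.init]
  · simp [hI, State.init]
  · simp [hI]
  · simp [State.init]
  · simp [State.init]
  · simp [hI, State.init]
  · simp [hI, State.init]
  · rw [hzero _ _ (by omega)]
  -- Before any query the best row is row 0, which holds `p`: non-negative weights whose answer has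
  -- value at least the initial score 0.
  · refine ⟨p, fun e => ?_, fun e => (hp e).1, ?_⟩
    · simp [hI, State.init]
    · rw [hzero _ _ (by omega)]
      exact nonadap_nonneg hp hf _
  · simp [hI, State.init]
  · exact hzero _ _ (by omega)
  · intro e
    rw [hzero _ _ (by omega)]
    exact hf.nonneg _
  · intro i e hi
    omega
  · intro i hi
    omega
  · rfl

theorem reaches_algorithm (hp : ∀ e, p e ∈ Set.Icc (0 : ℝ) 1) (hf : IsMaxOfSums a f)
    (hF : IsPrefixClosed F) (hO : IsLinearOracle F O) :
    Reaches O algorithm (State.init p a) (1000 * (W + 1) * (n + 1)) fun I _ qs =>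
      qs.length = 2 * W + 1 ∧ ∃ c ∈ qs, (∀ e, 0 ≤ c e) ∧ I 1 0 = (O c).length ∧
        (∀ (j : ℕ) (h : j < (O c).length), I 1 (j + 1) = (O c)[j]) ∧
        ∃ M V : ℝ, 0 ≤ M ∧ M ≤ V ∧ V ≤ nonadap p f (O c) ∧
          (∀ i, score O (fun e => p e * a i e) (fun _ => 0) ≤ M) ∧
          ∀ k < W, score O (largeWeight p f ((k + 1 : ℕ) * M))
            (largeProb p f ((k + 1 : ℕ) * M)) ≤ V := by
  have hinit : Reaches O (setReg 4 (.add (reg 1) (.const 3))) (State.init p a) 20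
      (SumInvariant p a f O 0) := by
    refine Reaches.mono (Reaches.setI (SumInvariant.init hp hf fun r c => ?_)) ?_ fun I R q h => h
    · simp only [State.writeI_I, IExp.eval, reg]
      rfl
    · simp [IExp.cost, reg]
  have hsum : ∀ u : State n, SumInvariant p a f O 0 u.I u.R u.queries →
      Reaches O (.loop (reg 1) sumPass) u (4 + W * (400 * (n + 1) + 1)) (SumInvariant p a f O W) :=
    fun u hu => Reaches.loop _ hu.memory.width hu fun j hj v hv => reaches_sumPass hp hf hF hO hj hv
  have hmid : ∀ u : State n, SumInvariant p a f O W u.I u.R u.queries →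
      Reaches O (setScalar 4 (scalar 0)) u 30 fun I R qs => ∃ M : ℝ, 0 ≤ M ∧
        (∀ i, score O (fun e => p e * a i e) (fun _ => 0) ≤ M) ∧
        ThresholdInvariant p a f O M 0 I R qs := by
    intro u hu
    have hm := hu.memory
    have hr := hm.row
    -- `M` is the best score of the first phase; it becomes the threshold increment.
    refine Reaches.mono (Reaches.setR ⟨u.R (W + 1) 0, hm.score_nonneg,
      fun i => hu.score_le i i.2, ?_⟩) ?_ fun I R q h => h
    · simp [scalar, scalarRow, reg, IExp.cost, RExp.cost]
    have hR : ∀ r c, (u.writeR (scalarRow.eval u) ((IExp.const 4).eval u)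
        ((scalar 0).eval u)).R r c = if r = W + 1 ∧ c = 4 then u.R (W + 1) 0 else u.R r c := by
      intro r c
      simp [scalar, scalarRow, reg, IExp.eval, RExp.eval, hm.width]
    generalize (u.writeR (scalarRow.eval u) ((IExp.const 4).eval u) ((scalar 0).eval u)).R = R
      at hR ⊢
    refine ⟨?_, ?_, ?_, ?_, ?_, ?_, ?_⟩
    · refine hm.congr (fun _ _ _ => rfl) (fun r c _ h2 _ => ?_) ?_
      · simp [hR, h2]
      · simp [hR]
    · simp [hR]
    · simp [hR, hu.threshold]
    · intro e
      rw [hR, if_neg (by omega)]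
      -- After all `W` passes the running maximum has met the summand attaining `f {e}`.
      obtain ⟨i, hi⟩ := hf.exists_eq {e}
      refine le_antisymm (hu.value_le e) ?_
      rw [hi, Finset.sum_singleton]
      exact hu.le_value i e i.2
    · simp [hR]
    · intro l hl
      omega
    · exact hu.length
  have hthreshold : ∀ (M : ℝ) (u : State n), ThresholdInvariant p a f O M 0 u.I u.R u.queries →
      Reaches O (.loop (reg 1) thresholdPass) u (4 + W * (400 * (n + 1) + 1))
        (ThresholdInvariant p a f O M W) :=
    fun M u hu => Reaches.loop _ hu.memory.width hu
      fun k _ v hv => reaches_thresholdPass hp hf hF hO hv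
  refine Reaches.mono (Reaches.seq hinit fun u hu => Reaches.seq (hsum u hu) fun u hu =>
    Reaches.seq (hmid u hu) (T' := 4 + W * (400 * (n + 1) + 1) + (n + 10)) ?_) ?_ fun I R q h => h
  swap
  · nlinarith
  rintro v ⟨M, hM0, hM, hv⟩
  refine Reaches.seq (hthreshold M v hv) fun u hu => ?_
  -- The oracle is a function of the weights, so repeating the best query reproduces the certified
  -- answer.
  obtain ⟨c, hc, hc0, hle⟩ := hu.memory.score_le
  have hc' : (fun e : Fin n => u.R (u.I 0 5) e) = c := funext hc
  refine Reaches.mono (Reaches.query ?_) ?_ fun I R q h => h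
  · simp only [reg, IExp.eval, hc']
    refine ⟨?_, c, by simp, hc0, ?_, fun j hj => ?_, M, u.R (W + 1) 0, hM0, hu.le_score, hle, hM,
      hu.score_le⟩
    · simp [hu.length, two_mul]
    · rw [State.ask_I_zero, hc']
    · have := u.ask_I_succ O (u.I 0 5) 1 (j := j) (by rwa [hc'])
      simpa [hc'] using this
  · simp only [reg, IExp.cost]
    omega

theorem output_eq {s : State n} {σ : List (Fin n)} (h0 : s.I 1 0 = σ.length)
    (h : ∀ (j : ℕ) (hj : j < σ.length), s.I 1 (j + 1) = σ[j]) : s.output = σ.map Fin.val := by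
  refine List.ext_getElem (by simp [State.output, h0]) fun j h1 h2 => ?_
  have hj : j < σ.length := by simpa using h2
  simp [State.output, h j hj]

end Algorithm

end StochasticProbing

/-! ### The approximation guarantee -/

open StochasticProbing
theorem mainTheorem4 :
    ∃ (P : Program) (C D : ℝ) (K d : ℕ), ∀ (n W : ℕ) (p : Fin n → ℝ) (a : Fin W → Fin n → ℝ)
      (f : Finset (Fin n) → ℝ) (F : Set (List (Fin n))) (O : (Fin n → ℝ) → List (Fin n)),
      (∀ e, p e ∈ Set.Icc (0 : ℝ) 1) → IsMaxOfSums a f → IsPrefixClosed F → IsLinearOracle F O →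
      -- the running time
      (P.run O p a).time ≤ K * (n + W) ^ d ∧
      -- the number of oracle calls
      ((P.run O p a).queries.length : ℝ) ≤ D * (W + Real.log n) ∧
      -- the output is a non-adaptive strategy, namely the oracle's answer to one of the queries,
      -- and it is within a factor `O(log W)` of every adaptive strategy
      ∃ σ ∈ F, (P.run O p a).output = σ.map Fin.val ∧
        (∃ c ∈ (P.run O p a).queries, σ = O c) ∧
        ∀ T : StrategyTree n, T.Feasible F →
          adap p f T ≤ C * (1 + Real.log W) * nonadap p f σ := by
  refine ⟨algorithm, 16, 3, 2000, 2, fun n W p a f F O hp hf hF hO => ?_⟩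
  obtain ⟨htime, hlen, c, hcq, hc0, h0, hj, M, V, hM0, hMV, hV, hM, hk⟩ :=
    reaches_algorithm hp hf hF hO
  have hW := hf.width_pos
  refine ⟨htime.trans ?_, ?_, O c, (hO c hc0).1, output_eq h0 hj, ⟨c, hcq, rfl⟩, fun T hT => ?_⟩
  · simp only [State.init]
    -- Both factors use `1 ≤ W`, which holds because the maximum defining `f` is attained; the same
    -- fact gives `2W + 1 ≤ 3W` for the queries.
    nlinarith [Nat.mul_le_mul (show W + 1 ≤ 2 * (n + W) by omega) (show n + 1 ≤ n + W by omega)]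
  · change ((algorithm.exec O (State.init p a)).queries.length : ℝ) ≤ _
    rw [hlen]
    have hW' : (1 : ℝ) ≤ W := by exact_mod_cast hW
    have := Real.log_natCast_nonneg n
    push_cast
    linarith
  · refine (adap_le_of_scores hp hf hF hO hM0 hMV hM hk hT).trans ?_
    have := Real.log_natCast_nonneg W
    exact mul_le_mul_of_nonneg_left hV (by positivity)
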